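/- Let $n\ge 1$, let $\Omega\subset\mathbb R^n$ be a bounded open set (for instance a bounded domain with smooth boundary), $\omega\subset\Omega$ open, $T>0$, $\alpha>0$, $R\in L^2(0,T;L^\infty(\Omega))$ and $u^\delta\in L^2(\omega\times(0,T))$, extended by $0$. All functions are real-valued. For $F\in L^2(\Omega\times(0,T))$, a generalized solution of $$\partial_t^2u=\Delta u+F\ \text{ in }\Omega\times(0,T),\qquad \partial_\nu u=0\ \text{ on }\partial\Omega\times(0,T),\qquad u=\partial_tu=0\ \text{ at }t=0$$ is a function $u\in H^1(\Omega\times(0,T))$ with $u|_{t=0}=0$ such that $$\int_0^T\!\!\int_\Omega\big(\nabla u\cdot\nabla v-\partial_tu\,\partial_tv\big)\,dx\,dt=\int_0^T\!\!\int_\Omega F\,v\,dx\,dt$$ for all $v\in H^1(\Omega\times(0,T))$ with $v|_{t=T}=0$. Generalized solutions of the backward problem, with $u=\partial_tu=0$ at $t=T$ instead, are defined in the same way with the roles of $t=0$ and $t=T$ exchanged, in the condition on the solution and in that on the test functions. For every $f\in L^2(\Omega)$, the problem with zero data at $t=0$ and $F(x,t)=f(x)R(x,t)$ has a unique generalized solution,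 denoted $u(f)$, and the backward (adjoint) problem $$\partial_t^2v-\Delta v=\chi_\omega\,(u(f)-u^\delta)\ \text{ in }\Omega\times(0,T),\qquad \partial_\nu v=0\ \text{ on }\partial\Omega\times(0,T),\qquad v=\partial_tv=0\ \text{ at }t=T$$ has a unique generalized solution, denoted $v(f)$. If $f^*\in L^2(\Omega)$ minimizes the functional $$J(f)=\|u(f)-u^\delta\|_{L^2(\omega\times(0,T))}^2+\alpha\|f\|_{L^2(\Omega)}^2$$ over $f\in L^2(\Omega)$, then it satisfies the Euler equation $$\int_0^TR(x,t)\,v(f^*)(x,t)\,dt+\alpha f^*(x)=0\qquad\text{for almost every }x\in\Omega .$$ -/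

import Mathlib

open MeasureTheory Set

noncomputable section

namespace NeumannWave

/-- `ℝⁿ` with its Euclidean structure. -/
abbrev Space (n : ℕ) := EuclideanSpace ℝ (Fin n)

/-- The space-time cylinder `Ω × (0,T)`. -/
def cyl {n : ℕ} (Ω : Set (Space n)) (T : ℝ) : Set (Space n × ℝ) := Ω ×ˢ Ioo 0 T

/-- The space `L²(Ω)`. -/
abbrev L2Space {n : ℕ} (Ω : Set (Space n)) := Lp ℝ 2 (volume.restrict Ω)

/-- The space `L²(Ω × (0,T))`. -/
abbrev L2Cyl {n : ℕ} (Ω : Set (Space n)) (T : ℝ) := Lp ℝ 2 (volume.restrict (cyl Ω T))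

/-- `g` is the weak derivative of `u` on the set `U` in the direction `e`, tested against all
smooth functions with compact support in `U`. -/
def HasWeakDeriv {n : ℕ} (U : Set (Space n × ℝ)) (u g : Space n × ℝ → ℝ) (e : Space n × ℝ) :
    Prop :=
  ∀ φ : Space n × ℝ → ℝ, ContDiff ℝ (⊤ : ℕ∞) φ → HasCompactSupport φ → tsupport φ ⊆ U →
    ∫ p in U, u p * fderiv ℝ φ p e = -∫ p in U, g p * φ p

/-- The `i`-th coordinate direction of `ℝⁿ`, as a direction in space-time. -/
def dirX {n : ℕ} (i : Fin n) : Space n × ℝ := (EuclideanSpace.single i 1, 0)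

/-- The time direction in space-time. -/
def dirT (n : ℕ) : Space n × ℝ := (0, 1)

/-- `u ∈ H¹(U)`: `u` and all its first order weak derivatives (in `x₁, …, xₙ` and `t`) are square
integrable on `U`. -/
def MemH1 {n : ℕ} (U : Set (Space n × ℝ)) (u : Space n × ℝ → ℝ) : Prop :=
  MemLp u 2 (volume.restrict U) ∧
  (∀ i : Fin n, ∃ g, MemLp g 2 (volume.restrict U) ∧ HasWeakDeriv U u g (dirX i)) ∧
  (∃ g, MemLp g 2 (volume.restrict U) ∧ HasWeakDeriv U u g (dirT n))

/-- The square integrable weak derivative of `u` on `U` in the direction `e`. For `U` open it is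
unique up to a null set where it exists; it exists in the coordinate directions if `MemH1 U u`. -/
def weakDeriv {n : ℕ} (U : Set (Space n × ℝ)) (u : Space n × ℝ → ℝ) (e : Space n × ℝ) :
    Space n × ℝ → ℝ :=
  Classical.epsilon fun g => MemLp g 2 (volume.restrict U) ∧ HasWeakDeriv U u g e

/-- `u|_{t = s} = 0` for `u ∈ H¹(Ω × (0,T))` and `s ∈ [0,T]`: the representative of `u` in
`C([0,T]; L²(Ω))` vanishes at `t = s`. -/
def TraceZero {n : ℕ} (Ω : Set (Space n)) (T s : ℝ) (u : Space n × ℝ → ℝ) : Prop :=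
  ∃ w : ℝ → L2Space Ω, ContinuousOn w (Icc 0 T) ∧
    (∀ᵐ t ∂(volume.restrict (Ioo 0 T)), (fun x => u (x, t)) =ᵐ[volume.restrict Ω] w t) ∧
    w s = 0

/-- The bilinear form `∫₀ᵀ ∫_Ω (∇u · ∇v - ∂ₜu ∂ₜv) dx dt`. -/
def waveForm {n : ℕ} (Ω : Set (Space n)) (T : ℝ) (u v : Space n × ℝ → ℝ) : ℝ :=
  ∫ p in cyl Ω T,
    ((∑ i : Fin n, weakDeriv (cyl Ω T) u (dirX i) p * weakDeriv (cyl Ω T) v (dirX i) p)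
      - weakDeriv (cyl Ω T) u (dirT n) p * weakDeriv (cyl Ω T) v (dirT n) p)

/-- `u` is a generalized solution of `∂ₜ²u = Δu + F` in `Ω × (0,T)`, `∂_ν u = 0` on
`∂Ω × (0,T)`, `u = ∂ₜu = 0` at `t = 0`. The condition `∂ₜu = 0` at `t = 0` and the Neumann condition
are encoded in the choice of the test functions. -/
def IsForwardSolution {n : ℕ} (Ω : Set (Space n)) (T : ℝ) (F u : Space n × ℝ → ℝ) : Prop :=
  MemH1 (cyl Ω T) u ∧ TraceZero Ω T 0 u ∧
  ∀ v : Space n × ℝ → ℝ, MemH1 (cyl Ω T) v → TraceZero Ω T T v →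
    waveForm Ω T u v = ∫ p in cyl Ω T, F p * v p

/-- `v` is a generalized solution of the backward problem `∂ₜ²v = Δv + F` in `Ω × (0,T)`,
`∂_ν v = 0` on `∂Ω × (0,T)`, `v = ∂ₜv = 0` at `t = T`. -/
def IsBackwardSolution {n : ℕ} (Ω : Set (Space n)) (T : ℝ) (F v : Space n × ℝ → ℝ) : Prop :=
  MemH1 (cyl Ω T) v ∧ TraceZero Ω T T v ∧
  ∀ w : Space n × ℝ → ℝ, MemH1 (cyl Ω T) w → TraceZero Ω T 0 w →
    waveForm Ω T v w = ∫ p in cyl Ω T, F p * w p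

/-- `R ∈ L²(0,T; L^∞(Ω))`. -/
def MemL2Linfty {n : ℕ} (Ω : Set (Space n)) (T : ℝ) (R : Space n × ℝ → ℝ) : Prop :=
  AEStronglyMeasurable R (volume.restrict (cyl Ω T)) ∧
  ∫⁻ t in Ioo 0 T, (eLpNorm (fun x => R (x, t)) ⊤ (volume.restrict Ω)) ^ 2 < ⊤

/-- The source term `f(x) R(x,t)`. -/
def source {n : ℕ} {Ω : Set (Space n)} (R : Space n × ℝ → ℝ) (f : L2Space Ω) :
    Space n × ℝ → ℝ :=
  fun p => f p.1 * R p

/-- `u(f)`: the generalized solution of the forward problem with source `f R`. -/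
def fwd {n : ℕ} {Ω : Set (Space n)} (T : ℝ) (R : Space n × ℝ → ℝ) (f : L2Space Ω) :
    L2Cyl Ω T :=
  Classical.epsilon fun u : L2Cyl Ω T => IsForwardSolution Ω T (source R f) u

/-- The source `χ_ω (u(f) - u^δ)` of the adjoint problem. -/
def adjointSource {n : ℕ} {Ω ω : Set (Space n)} (T : ℝ) (R : Space n × ℝ → ℝ)
    (uδ : L2Cyl ω T) (f : L2Space Ω) : Space n × ℝ → ℝ :=
  {p : Space n × ℝ | p.1 ∈ ω}.indicator fun p => fwd T R f p - uδ p

/-- `v(f)`: the generalized solution of the adjoint problem. -/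
def bwd {n : ℕ} {Ω ω : Set (Space n)} (T : ℝ) (R : Space n × ℝ → ℝ)
    (uδ : L2Cyl ω T) (f : L2Space Ω) : L2Cyl Ω T :=
  Classical.epsilon fun v : L2Cyl Ω T => IsBackwardSolution Ω T (adjointSource T R uδ f) v

/-- The Tikhonov functional `J(f) = ‖u(f) - u^δ‖²_{L²(ω × (0,T))} + α ‖f‖²_{L²(Ω)}`. -/
def tikhonov {n : ℕ} {Ω ω : Set (Space n)} (T α : ℝ) (R : Space n × ℝ → ℝ)
    (uδ : L2Cyl ω T) (f : L2Space Ω) : ℝ :=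
  (∫ p in cyl ω T, (fwd T R f p - uδ p) ^ 2) + α * ‖f‖ ^ 2

end NeumannWave

end

/-!
The argument stays in space-time and needs no regularity of `∂Ω`, no spectral theory and no
Galerkin approximation.

A function of `H¹(Ω × (0,T))` that vanishes at time `s ∈ {0, T}` is the primitive in time, based
at `s`, of its time derivative (`ae_eq_timePrimitive_of_traceZero`, `traceZero_timePrimitive`). It
is thus determined by its space-time gradient, and these gradients form a closed subspace
`gradSpace` of `L²(Ω × (0,T))ⁿ⁺¹`, on which `waveForm` is the bounded symmetric form `⟪z, K w⟫`
with `K` the change of sign of the time component (`waveForm_eq_inner`).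

Well-posedness rests on a single coercivity estimate, `exists_gradSpace_coercive`. For the forward
problem let `v` vanish at `t = T`, and put `φ(t) = ∫₀ᵗ eʳ v(r) dr`, which vanishes at `t = 0`.
Since `∂ₜφ = eᵗ v` and `∇v = e⁻ᵗ ∂ₜ∇φ`, integration by parts in time gives
`waveForm φ v = ∫∫ (e⁻ᵗ ∂ₜ(|∇φ|²) - eᵗ ∂ₜ(v²)) / 2 ≥ ½ ∫∫ (e⁻ᵗ |∇φ|² + eᵗ v²)`,
because the boundary terms have the good sign. This bounds `waveForm φ v` below by the square of the norm of the gradient of `φ`. By Lions'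
variant of the Lax-Milgram theorem (`exists_mem_forall_inner_eq`) it yields existence for the
forward problem, and by the symmetry of `waveForm` it yields uniqueness for the backward problem.
Reversing time, that is, exchanging the two ends and the sign of the exponent, gives the other two
statements; all lemmas treat both directions at once (`OppositeEnds`).

For the Euler equation, uniqueness makes `f ↦ u(f)` linear, so `J(f* + ε h)` is a quadratic
polynomial in `ε` (`tikhonov_add_smul`) whose linear coefficient vanishes at a minimizer:
`∫∫_ω (u(f*) - u^δ) u(h) + α ⟪f*, h⟫ = 0`. Testing the adjoint equation with `u(h)` and the forward
equation with `v(f*)` turns the first term into `∫∫ h R v(f*)`, and taking for `h` indicator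
functions gives the pointwise equation.
-/

noncomputable section

namespace NeumannWave

/-! ### Calculus of primitives in one variable -/

theorem integral_primitive_mul_deriv {k η : ℝ → ℝ} {a b s : ℝ}
    (hk : IntervalIntegrable k volume a b) (hs : s ∈ uIcc a b) (hη : ContDiff ℝ 1 η) :
    ∫ t in a..b, (∫ r in s..t, k r) * deriv η t =
      (∫ r in s..b, k r) * η b - (∫ r in s..a, k r) * η a - ∫ t in a..b, k t * η t := by
  rw [(hk.absolutelyContinuousOnInterval_intervalIntegral hs).integral_mul_deriv_eq_deriv_mul
    hη.contDiffOn.absolutelyContinuousOnInterval]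
  congr 1
  apply intervalIntegral.integral_congr_ae
  filter_upwards [hk.ae_hasDerivAt_integral] with t ht htab
  rw [(ht (uIoc_subset_uIcc htab) s hs).deriv]

/-- The energy identity: for the primitive `H` of `k` based at `s`, integrate
`e^(τ t) (H²)'` by parts. -/
theorem two_mul_integral_exp_mul_primitive {k : ℝ → ℝ} {a b s : ℝ} (τ : ℝ)
    (hk : IntervalIntegrable k volume a b) (hs : s ∈ uIcc a b) :
    2 * ∫ t in a..b, Real.exp (τ * t) * ((∫ r in s..t, k r) * k t) =
      Real.exp (τ * b) * (∫ r in s..b, k r) ^ 2 - Real.exp (τ * a) * (∫ r in s..a, k r) ^ 2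
        - τ * ∫ t in a..b, Real.exp (τ * t) * (∫ r in s..t, k r) ^ 2 := by
  set H : ℝ → ℝ := fun t => ∫ r in s..t, k r with hH
  have hHac : AbsolutelyContinuousOnInterval H a b :=
    hk.absolutelyContinuousOnInterval_intervalIntegral hs
  have he : AbsolutelyContinuousOnInterval (fun t => Real.exp (τ * t)) a b :=
    ContDiffOn.absolutelyContinuousOnInterval (by fun_prop)
  have key := (he.mul hHac).integral_deriv_mul_eq_sub hHac
  have hint : IntervalIntegrable (fun t => Real.exp (τ * t) * (H t * k t)) volume a b := by
    refine (hk.continuousOn_mul (g := fun t => Real.exp (τ * t) * H t)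
      (he.continuousOn.mul hHac.continuousOn)).congr ?_
    exact fun t _ => by ring
  have hint2 : IntervalIntegrable (fun t => Real.exp (τ * t) * (H t) ^ 2) volume a b :=
    (he.continuousOn.mul (hHac.continuousOn.pow 2)).intervalIntegrable
  have e : ∫ t in a..b, deriv ((fun t => Real.exp (τ * t)) * H) t * H t
        + ((fun t => Real.exp (τ * t)) * H) t * deriv H t
      = ∫ t in a..b, (2 * (Real.exp (τ * t) * (H t * k t))
        + τ * (Real.exp (τ * t) * (H t) ^ 2)) := by
    apply intervalIntegral.integral_congr_ae
    filter_upwards [hk.ae_hasDerivAt_integral] with t ht htab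
    have h1 : HasDerivAt H (k t) t := ht (uIoc_subset_uIcc htab) s hs
    have h2 : HasDerivAt (fun t => Real.exp (τ * t)) (Real.exp (τ * t) * τ) t := by
      simpa using ((hasDerivAt_id t).const_mul τ).exp
    rw [(h2.mul h1).deriv, h1.deriv]
    simp only [Pi.mul_apply]
    ring
  rw [e, intervalIntegral.integral_add (hint.const_mul 2) (hint2.const_mul τ),
    intervalIntegral.integral_const_mul, intervalIntegral.integral_const_mul] at key
  simp only [Pi.mul_apply] at key
  linarith

/-- The lemma of du Bois-Reymond: a function with vanishing weak derivative is constant. -/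
theorem exists_ae_eq_const_of_integral_mul_deriv_eq_zero {d : ℝ → ℝ} {a b : ℝ} (hab : a < b)
    (hd : IntegrableOn d (Ioo a b))
    (h : ∀ η : ℝ → ℝ, ContDiff ℝ (⊤ : ℕ∞) η → HasCompactSupport η → tsupport η ⊆ Ioo a b →
      ∫ t in Ioo a b, d t * deriv η t = 0) :
    ∃ c, ∀ᵐ t ∂(volume.restrict (Ioo a b)), d t = c := by
  -- a bump function of integral one
  let B : ContDiffBump ((a + b) / 2) :=
    ⟨(b - a) / 8, (b - a) / 4, by linarith, by linarith⟩
  let η₀ : ℝ → ℝ := B.normed volume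
  have hη₀ : ContDiff ℝ (⊤ : ℕ∞) η₀ := B.contDiff_normed
  have hη₀c : HasCompactSupport η₀ := B.hasCompactSupport_normed
  have hη₀s : tsupport η₀ ⊆ Ioo a b := by
    rw [B.tsupport_normed_eq, Real.closedBall_eq_Icc]
    intro t ht
    have h1 := ht.1
    have h2 := ht.2
    simp only [B] at h1 h2
    constructor <;> linarith
  have hη₀i : ∫ t, η₀ t = 1 := B.integral_normed
  have hbd : ∀ ψ : ℝ → ℝ, Continuous ψ → HasCompactSupport ψ →
      IntegrableOn (fun t => d t * ψ t) (Ioo a b) := by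
    intro ψ hψ hψc
    obtain ⟨C, hC⟩ := hψc.exists_bound_of_continuous hψ
    exact Integrable.mul_bdd hd hψ.aestronglyMeasurable (Filter.Eventually.of_forall hC)
  let c := ∫ t in Ioo a b, d t * η₀ t
  refine ⟨c, ?_⟩
  have hloc : LocallyIntegrableOn (fun t => d t - c) (Ioo a b) :=
    IntegrableOn.locallyIntegrableOn (hd.sub (integrableOn_const (by simp)))
  have := isOpen_Ioo.ae_eq_zero_of_integral_contDiff_smul_eq_zero hloc ?_
  · rw [ae_restrict_iff' measurableSet_Ioo]
    filter_upwards [this] with t ht hm using by linarith [ht hm]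
  intro ψ hψ hψc hψs
  -- subtracting a multiple of the bump function leaves a test function with integral zero
  set m := ∫ t, ψ t with hm
  let ζ : ℝ → ℝ := fun t => ψ t - m * η₀ t
  have hζ : ContDiff ℝ (⊤ : ℕ∞) ζ := hψ.sub (contDiff_const.mul hη₀)
  have hζc : HasCompactSupport ζ := hψc.sub hη₀c.mul_left
  have hζs : tsupport ζ ⊆ Ioo a b := by
    refine (closure_mono (t := Function.support ψ ∪ Function.support η₀) ?_).trans ?_
    · intro t ht
      by_contra hcon
      simp only [mem_union, Function.mem_support, not_or, not_not] at hcon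
      exact ht (by simp [ζ, hcon.1, hcon.2])
    · rw [closure_union]
      exact union_subset hψs hη₀s
  have hζi : ∫ t, ζ t = 0 := by
    have : ∫ t, ζ t = (∫ t, ψ t) - ∫ t, m * η₀ t :=
      integral_sub (hψ.continuous.integrable_of_hasCompactSupport hψc)
        ((hη₀.continuous.integrable_of_hasCompactSupport hη₀c).const_mul m)
    rw [this, integral_const_mul, hη₀i, ← hm]
    ring
  have hζint : Integrable ζ := hζ.continuous.integrable_of_hasCompactSupport hζc
  have hζ0 : ∀ t, t ∉ tsupport ζ → ζ t = 0 := fun t ht => image_eq_zero_of_notMem_tsupport ht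
  -- the primitive of `ζ` is again a test function
  let η : ℝ → ℝ := fun t => ∫ r in a..t, ζ r
  have hηd : ∀ t, HasDerivAt η (ζ t) t := fun t =>
    intervalIntegral.integral_hasDerivAt_right (hζ.continuous.intervalIntegrable _ _)
      (hζ.continuous.stronglyMeasurableAtFilter _ _) hζ.continuous.continuousAt
  have hηderiv : deriv η = ζ := funext fun t => (hηd t).deriv
  have hηs : ContDiff ℝ (⊤ : ℕ∞) η := by
    rw [contDiff_infty_iff_deriv]
    exact ⟨fun t => (hηd t).differentiableAt, hηderiv ▸ hζ⟩
  obtain ⟨p, q, hpa, hqb, hpq, hsupp⟩ :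
      ∃ p q : ℝ, a < p ∧ q < b ∧ p ≤ q ∧ tsupport ζ ⊆ Icc p q := by
    rcases (tsupport ζ).eq_empty_or_nonempty with he | hne
    · exact ⟨(a + b) / 2, (a + b) / 2, by linarith, by linarith, le_rfl, by simp [he]⟩
    · have hcpt : IsCompact (tsupport ζ) := hζc
      have h1 := hcpt.sInf_mem hne
      have h2 := hcpt.sSup_mem hne
      exact ⟨_, _, (hζs h1).1, (hζs h2).2, csInf_le hcpt.bddBelow h2,
        fun t ht => ⟨csInf_le hcpt.bddBelow ht, le_csSup hcpt.bddAbove ht⟩⟩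
  have hηsupp : tsupport η ⊆ Icc p q := by
    refine closure_minimal (fun t ht => ?_) isClosed_Icc
    by_contra hcon
    apply ht
    rcases lt_or_ge t p with htp | htp
    · have : EqOn ζ 0 (uIcc a t) := fun r hr => by
        refine hζ0 r fun hr' => ?_
        have h1 := (hsupp hr').1
        rcases le_total a t with hat | hat
        · rw [uIcc_of_le hat] at hr; linarith [hr.2]
        · rw [uIcc_of_ge hat] at hr; linarith [hr.2]
      simp [η, intervalIntegral.integral_congr this]
    · have htq : q < t := by
        by_contra hq
        exact hcon ⟨htp, not_lt.mp hq⟩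
      change ∫ r in a..t, ζ r = 0
      rw [intervalIntegral.integral_eq_integral_of_support_subset, hζi]
      intro r hr
      have := hsupp (subset_tsupport _ hr)
      exact ⟨by linarith [this.1], by linarith [this.2]⟩
  have key := h η hηs (isCompact_Icc.of_isClosed_subset (isClosed_tsupport η) hηsupp)
    (hηsupp.trans fun t ht => ⟨by linarith [ht.1], by linarith [ht.2]⟩)
  rw [hηderiv] at key
  have hψI : ∫ t in Ioo a b, ψ t = m :=
    setIntegral_eq_integral_of_forall_compl_eq_zero fun t ht =>
      image_eq_zero_of_notMem_tsupport fun ht' => ht (hψs ht')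
  have h1 : ∫ t in Ioo a b, d t * ζ t = (∫ t in Ioo a b, d t * ψ t) - m * c := by
    rw [← integral_const_mul, ← integral_sub (hbd ψ hψ.continuous hψc)
      ((hbd η₀ hη₀.continuous hη₀c).const_mul m)]
    congr 1
    ext t
    simp only [ζ]
    ring
  have h2 : ∫ t, ψ t • (d t - c) = ∫ t in Ioo a b, (d t * ψ t - c * ψ t) := by
    rw [← setIntegral_eq_integral_of_forall_compl_eq_zero (s := Ioo a b)]
    · congr 1
      ext t
      simp only [smul_eq_mul]
      ring
    · intro t ht
      rw [image_eq_zero_of_notMem_tsupport fun ht' => ht (hψs ht'), zero_smul]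
  rw [h2, integral_sub (hbd ψ hψ.continuous hψc)
    ((hψ.continuous.integrable_of_hasCompactSupport hψc).integrableOn.const_mul c),
    integral_const_mul, hψI]
  linarith

/-! ### Primitives in time on the cylinder -/

variable {n : ℕ} {Ω : Set (Space n)} {T : ℝ}

theorem restrict_cyl (Ω : Set (Space n)) (T : ℝ) :
    (volume : Measure (Space n × ℝ)).restrict (cyl Ω T) =
      (volume.restrict Ω).prod (volume.restrict (Ioo 0 T)) := by
  rw [Measure.prod_restrict]
  rfl

theorem ae_cyl_of_ae_fst {P : Space n → Prop} (h : ∀ᵐ x ∂(volume.restrict Ω), P x) :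
    ∀ᵐ p ∂(volume.restrict (cyl Ω T)), P p.1 := by
  rw [restrict_cyl]
  exact Measure.quasiMeasurePreserving_fst.ae h

theorem ae_cyl_of_ae_snd {P : ℝ → Prop} (h : ∀ᵐ t ∂(volume.restrict (Ioo 0 T)), P t) :
    ∀ᵐ p ∂(volume.restrict (cyl Ω T)), P p.2 := by
  rw [restrict_cyl]
  exact Measure.quasiMeasurePreserving_snd.ae h

theorem ae_cyl_snd_mem (Ω : Set (Space n)) (T : ℝ) :
    ∀ᵐ p ∂(volume.restrict (cyl Ω T)), p.2 ∈ Ioo 0 T :=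
  ae_cyl_of_ae_snd (ae_restrict_mem measurableSet_Ioo)

theorem ae_ae_of_ae_cyl {P : Space n × ℝ → Prop} (h : ∀ᵐ p ∂(volume.restrict (cyl Ω T)), P p) :
    ∀ᵐ x ∂(volume.restrict Ω), ∀ᵐ t ∂(volume.restrict (Ioo 0 T)), P (x, t) := by
  rw [restrict_cyl] at h
  exact Measure.ae_ae_of_ae_prod h

theorem ae_ae_swap_of_ae_cyl {P : Space n × ℝ → Prop}
    (h : ∀ᵐ p ∂(volume.restrict (cyl Ω T)), P p) :
    ∀ᵐ t ∂(volume.restrict (Ioo 0 T)), ∀ᵐ x ∂(volume.restrict Ω), P (x, t) := by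
  rw [restrict_cyl] at h
  exact Measure.ae_ae_of_ae_prod (Measure.measurePreserving_swap.quasiMeasurePreserving.ae h)

theorem memLp_slice_time {h : Space n × ℝ → ℝ} (hh : MemLp h 2 (volume.restrict (cyl Ω T))) :
    ∀ᵐ x ∂(volume.restrict Ω), MemLp (fun t => h (x, t)) 2 (volume.restrict (Ioo 0 T)) := by
  rw [restrict_cyl] at hh
  filter_upwards [hh.1.prodMk_left, hh.integrable_sq.prod_right_ae] with x h1 h2
  exact (memLp_two_iff_integrable_sq h1).2 h2

theorem memLp_slice_space {h : Space n × ℝ → ℝ} (hh : MemLp h 2 (volume.restrict (cyl Ω T))) :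
    ∀ᵐ t ∂(volume.restrict (Ioo 0 T)), MemLp (fun x => h (x, t)) 2 (volume.restrict Ω) := by
  rw [restrict_cyl] at hh
  filter_upwards [hh.1.prodMk_right, hh.integrable_sq.prod_left_ae] with x h1 h2
  exact (memLp_two_iff_integrable_sq h1).2 h2

theorem intervalIntegrable_of_integrableOn_Ioo {k : ℝ → ℝ} {a b : ℝ}
    (hk : IntegrableOn k (Ioo 0 T)) (ha : a ∈ Icc 0 T) (hb : b ∈ Icc 0 T) :
    IntervalIntegrable k volume a b := by
  rw [intervalIntegrable_iff]
  rw [← integrableOn_Icc_iff_integrableOn_Ioo] at hk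
  exact hk.mono_set (uIoc_subset_uIcc.trans (uIcc_subset_Icc ha hb))

theorem integrableOn_Ioo_of_memLp {k : ℝ → ℝ} (hk : MemLp k 2 (volume.restrict (Ioo 0 T))) :
    IntegrableOn k (Ioo 0 T) := hk.integrable (by norm_num)

theorem intervalIntegrable_of_memLp {k : ℝ → ℝ} {a b : ℝ}
    (hk : MemLp k 2 (volume.restrict (Ioo 0 T))) (ha : a ∈ Icc 0 T) (hb : b ∈ Icc 0 T) :
    IntervalIntegrable k volume a b :=
  intervalIntegrable_of_integrableOn_Ioo (integrableOn_Ioo_of_memLp hk) ha hb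

theorem intervalIntegral_congr_Ioo {k l : ℝ → ℝ} {a b : ℝ}
    (h : ∀ᵐ t ∂(volume.restrict (Ioo 0 T)), k t = l t) (ha : a ∈ Icc 0 T) (hb : b ∈ Icc 0 T) :
    ∫ t in a..b, k t = ∫ t in a..b, l t := by
  apply intervalIntegral.integral_congr_ae_restrict
  refine ae_mono (Measure.restrict_mono (uIoc_subset_uIcc.trans (uIcc_subset_Icc ha hb)) le_rfl) ?_
  rwa [restrict_Ioo_eq_restrict_Icc] at h

theorem integral_Ioo_eq_intervalIntegral (hT : 0 ≤ T) (k : ℝ → ℝ) :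
    ∫ t in Ioo 0 T, k t = ∫ t in 0..T, k t := by
  rw [intervalIntegral.integral_of_le hT, integral_Ioc_eq_integral_Ioo]

/-- The Cauchy-Schwarz inequality for `k · 1`. -/
theorem sq_integral_le_mul_integral_sq {k : ℝ → ℝ} {a b : ℝ}
    (hk : MemLp k 2 (volume.restrict (Ioo 0 T))) (ha : a ∈ Icc 0 T) (hb : b ∈ Icc 0 T) :
    (∫ t in a..b, k t) ^ 2 ≤ |b - a| * ∫ t in Ioo 0 T, k t ^ 2 := by
  wlog hab : a ≤ b generalizing a b
  · rw [intervalIntegral.integral_symm, neg_sq, abs_sub_comm]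
    exact this hb ha (not_le.mp hab).le
  have hsq : IntegrableOn (fun t => k t ^ 2) (Ioo 0 T) := hk.integrable_sq
  have h1 := intervalIntegrable_of_integrableOn_Ioo hsq ha hb
  have h2 := intervalIntegrable_of_memLp hk ha hb
  have h3 : ∫ t in a..b, k t ^ 2 ≤ ∫ t in Ioo 0 T, k t ^ 2 := by
    rw [integral_Ioo_eq_intervalIntegral (ha.1.trans ha.2)]
    exact intervalIntegral.integral_mono_interval ha.1 hab hb.2
      (Filter.Eventually.of_forall fun t => sq_nonneg _)
      (intervalIntegrable_of_integrableOn_Ioo hsq ⟨le_rfl, ha.1.trans ha.2⟩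
        ⟨ha.1.trans ha.2, le_rfl⟩)
  rw [abs_of_nonneg (by linarith)]
  refine le_trans ?_ (mul_le_mul_of_nonneg_left h3 (by linarith))
  rcases hab.eq_or_lt with rfl | hlt
  · simp
  -- expand the nonnegative integral of `(k - m)²`, with `m` the mean of `k`
  set m := (∫ t in a..b, k t) / (b - a) with hm
  have h4 : 0 ≤ ∫ t in a..b, (k t - m) ^ 2 :=
    intervalIntegral.integral_nonneg hab fun t _ => sq_nonneg _
  have h5 : ∫ t in a..b, (k t - m) ^ 2 =
      (∫ t in a..b, k t ^ 2) - 2 * m * (∫ t in a..b, k t) + m ^ 2 * (b - a) := by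
    have : (fun t => (k t - m) ^ 2) = fun t => (k t ^ 2 - 2 * m * k t) + m ^ 2 := by
      ext t; ring
    rw [this, intervalIntegral.integral_add (h1.sub (h2.const_mul _)) (by simp),
      intervalIntegral.integral_sub h1 (h2.const_mul _), intervalIntegral.integral_const_mul]
    simp only [intervalIntegral.integral_const, smul_eq_mul]
    ring
  have h6 : (∫ t in a..b, k t) = m * (b - a) := by
    rw [hm, div_mul_cancel₀]; linarith
  rw [h6] at h5 ⊢
  have := mul_nonneg (sub_nonneg.2 hab) h4
  rw [h5] at this
  nlinarith

/-- The primitive in time `(x, t) ↦ ∫ₛᵗ h(x, r) dr`, with the signed interval integral, so that both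
ends `s = 0` and `s = T` of the time interval are covered. -/
def timePrimitive (s : ℝ) (h : Space n × ℝ → ℝ) : Space n × ℝ → ℝ :=
  fun p => ∫ r in s..p.2, h (p.1, r)

theorem timePrimitive_congr {s : ℝ} (hs : s ∈ Icc 0 T) {h h' : Space n × ℝ → ℝ}
    (hh : h =ᵐ[volume.restrict (cyl Ω T)] h') :
    timePrimitive s h =ᵐ[volume.restrict (cyl Ω T)] timePrimitive s h' := by
  filter_upwards [ae_cyl_of_ae_fst (T := T) (ae_ae_of_ae_cyl hh), ae_cyl_snd_mem Ω T]
    with p hp hpT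
  exact intervalIntegral_congr_Ioo hp hs (Ioo_subset_Icc_self hpT)

theorem stronglyMeasurable_timePrimitive (s : ℝ) {h : Space n × ℝ → ℝ}
    (hh : StronglyMeasurable h) : StronglyMeasurable (timePrimitive s h) := by
  have key : ∀ S : Set ((Space n × ℝ) × ℝ), MeasurableSet S →
      StronglyMeasurable fun p : Space n × ℝ => ∫ r, S.indicator (fun q => h (q.1.1, q.2)) (p, r) :=
    fun S hS => StronglyMeasurable.integral_prod_right'
      ((hh.comp_measurable (by fun_prop)).indicator hS)
  have h1 := key {q | s < q.2 ∧ q.2 ≤ q.1.2}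
    ((measurableSet_lt measurable_const measurable_snd).inter
      (measurableSet_le measurable_snd (measurable_snd.comp measurable_fst)))
  have h2 := key {q | q.1.2 < q.2 ∧ q.2 ≤ s}
    ((measurableSet_lt (measurable_snd.comp measurable_fst) measurable_snd).inter
      (measurableSet_le measurable_snd measurable_const))
  convert h1.sub h2 using 1
  ext p
  simp only [timePrimitive, intervalIntegral, Pi.sub_apply]
  rw [← integral_indicator measurableSet_Ioc, ← integral_indicator measurableSet_Ioc]
  rfl

theorem integrable_fst_of_integrable_cyl {h : Space n → ℝ}
    (hh : Integrable h (volume.restrict Ω)) :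
    Integrable (fun p : Space n × ℝ => h p.1) (volume.restrict (cyl Ω T)) := by
  rw [restrict_cyl]
  exact hh.comp_fst _

theorem sq_timePrimitive_le {s : ℝ} (hs : s ∈ Icc 0 T) {h : Space n × ℝ → ℝ}
    (hh : MemLp h 2 (volume.restrict (cyl Ω T))) :
    ∀ᵐ p ∂(volume.restrict (cyl Ω T)),
      timePrimitive s h p ^ 2 ≤ T * ∫ r in Ioo 0 T, h (p.1, r) ^ 2 := by
  filter_upwards [ae_cyl_of_ae_fst (T := T) (memLp_slice_time hh), ae_cyl_snd_mem Ω T]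
    with p hp hpT
  refine (sq_integral_le_mul_integral_sq hp hs (Ioo_subset_Icc_self hpT)).trans ?_
  refine mul_le_mul_of_nonneg_right ?_ (integral_nonneg fun r => sq_nonneg _)
  rw [abs_le]
  constructor <;> linarith [hs.1, hs.2, hpT.1, hpT.2]

theorem integrable_integral_sq {h : Space n × ℝ → ℝ}
    (hh : MemLp h 2 (volume.restrict (cyl Ω T))) :
    Integrable (fun x => ∫ r in Ioo 0 T, h (x, r) ^ 2) (volume.restrict Ω) := by
  have := hh.integrable_sq
  rw [restrict_cyl] at this
  exact this.integral_prod_left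

theorem memLp_timePrimitive {s : ℝ} (hs : s ∈ Icc 0 T) {h : Space n × ℝ → ℝ}
    (hh : MemLp h 2 (volume.restrict (cyl Ω T))) :
    MemLp (timePrimitive s h) 2 (volume.restrict (cyl Ω T)) := by
  have hm : AEStronglyMeasurable (timePrimitive s h) (volume.restrict (cyl Ω T)) :=
    ⟨_, stronglyMeasurable_timePrimitive s hh.1.stronglyMeasurable_mk,
      timePrimitive_congr hs hh.1.ae_eq_mk⟩
  rw [memLp_two_iff_integrable_sq hm]
  refine ((integrable_fst_of_integrable_cyl (integrable_integral_sq hh)).const_mul T).mono'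
    (hm.pow 2) ?_
  filter_upwards [sq_timePrimitive_le hs hh] with p hp
  rwa [Real.norm_of_nonneg (sq_nonneg _)]

theorem integral_cyl (f : Space n × ℝ → ℝ) (hf : Integrable f (volume.restrict (cyl Ω T))) :
    ∫ p in cyl Ω T, f p = ∫ x in Ω, ∫ t in Ioo 0 T, f (x, t) := by
  rw [restrict_cyl] at hf ⊢
  exact integral_prod f hf

theorem integral_cyl_symm (f : Space n × ℝ → ℝ)
    (hf : Integrable f (volume.restrict (cyl Ω T))) :
    ∫ p in cyl Ω T, f p = ∫ t in Ioo 0 T, ∫ x in Ω, f (x, t) := by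
  rw [restrict_cyl] at hf ⊢
  exact integral_prod_symm f hf

theorem integral_sq_timePrimitive_le {s : ℝ} (hs : s ∈ Icc 0 T) {h : Space n × ℝ → ℝ}
    (hh : MemLp h 2 (volume.restrict (cyl Ω T))) :
    ∫ p in cyl Ω T, timePrimitive s h p ^ 2 ≤ T ^ 2 * ∫ p in cyl Ω T, h p ^ 2 := by
  have hT : 0 ≤ T := hs.1.trans hs.2
  have hi := (integrable_fst_of_integrable_cyl (T := T) (integrable_integral_sq hh)).const_mul T
  refine (integral_mono_ae (memLp_timePrimitive hs hh).integrable_sq hi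
    (sq_timePrimitive_le hs hh)).trans_eq ?_
  rw [integral_cyl _ hi, integral_cyl _ hh.integrable_sq, ← integral_const_mul]
  congr 1
  ext x
  simp [hT]
  ring

/-! ### Weak derivatives -/

theorem isOpen_cyl (hΩ : IsOpen Ω) (T : ℝ) : IsOpen (cyl Ω T) := hΩ.prod isOpen_Ioo

theorem HasWeakDeriv.congr {U : Set (Space n × ℝ)} {u u' g g' : Space n × ℝ → ℝ}
    {e : Space n × ℝ} (h : HasWeakDeriv U u g e) (hu : u =ᵐ[volume.restrict U] u')
    (hg : g =ᵐ[volume.restrict U] g') : HasWeakDeriv U u' g' e := by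
  intro φ hφ hφc hφs
  have h1 : ∫ p in U, u' p * fderiv ℝ φ p e = ∫ p in U, u p * fderiv ℝ φ p e :=
    integral_congr_ae (by filter_upwards [hu] with p hp using by rw [hp])
  have h2 : ∫ p in U, g' p * φ p = ∫ p in U, g p * φ p :=
    integral_congr_ae (by filter_upwards [hg] with p hp using by rw [hp])
  rw [h1, h2, h φ hφ hφc hφs]

theorem integrable_mul_of_memLp_two {α : Type*} [MeasurableSpace α] {μ : Measure α} {f g : α → ℝ}
    (hf : MemLp f 2 μ) (hg : MemLp g 2 μ) : Integrable (fun p => f p * g p) μ :=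
  hf.integrable_mul hg

theorem memLp_of_test {E : Type*} [NormedAddCommGroup E] [MeasurableSpace E]
    [BorelSpace E] {φ : E → ℝ} {μ : Measure E} [IsFiniteMeasureOnCompacts μ]
    (hφ : Continuous φ) (hφc : HasCompactSupport φ) :
    MemLp φ 2 μ := hφ.memLp_of_hasCompactSupport hφc

theorem memLp_fderiv_of_test {E : Type*} [NormedAddCommGroup E] [NormedSpace ℝ E]
    [MeasurableSpace E] [BorelSpace E] {φ : E → ℝ} {μ : Measure E} [IsFiniteMeasureOnCompacts μ]
    (hφ : ContDiff ℝ (⊤ : ℕ∞) φ) (hφc : HasCompactSupport φ) (e : E) :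
    MemLp (fun p => fderiv ℝ φ p e) 2 μ :=
  memLp_of_test ((hφ.continuous_fderiv (by simp)).clm_apply continuous_const)
    (hφc.fderiv_apply (𝕜 := ℝ) e)

theorem ae_eq_zero_of_forall_test {E : Type*} [NormedAddCommGroup E] [NormedSpace ℝ E]
    [FiniteDimensional ℝ E] [MeasurableSpace E] [BorelSpace E] {μ : Measure E}
    {U : Set E} (hU : IsOpen U) {p : ENNReal} (hp : 1 ≤ p) {g : E → ℝ}
    [IsLocallyFiniteMeasure μ] (hg : MemLp g p (μ.restrict U))
    (h : ∀ φ : E → ℝ, ContDiff ℝ (⊤ : ℕ∞) φ → HasCompactSupport φ → tsupport φ ⊆ U →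
      ∫ x in U, g x * φ x ∂μ = 0) :
    g =ᵐ[μ.restrict U] 0 := by
  have := hU.ae_eq_zero_of_integral_contDiff_smul_eq_zero (μ := μ) (f := g)
    (locallyIntegrableOn_of_locallyIntegrable_restrict (hg.locallyIntegrable hp)) ?_
  · rw [Filter.EventuallyEq, ae_restrict_iff' hU.measurableSet]
    exact this
  · intro φ hφ hφc hφs
    rw [← h φ hφ hφc hφs, setIntegral_eq_integral_of_forall_compl_eq_zero]
    · simp only [smul_eq_mul, mul_comm]
    · intro x hx
      rw [image_eq_zero_of_notMem_tsupport fun hx' => hx (hφs hx'), mul_zero]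

theorem HasWeakDeriv.unique {U : Set (Space n × ℝ)} (hU : IsOpen U)
    {u g g' : Space n × ℝ → ℝ} {e : Space n × ℝ}
    (hg : MemLp g 2 (volume.restrict U)) (hg' : MemLp g' 2 (volume.restrict U))
    (h : HasWeakDeriv U u g e) (h' : HasWeakDeriv U u g' e) : g =ᵐ[volume.restrict U] g' := by
  have := ae_eq_zero_of_forall_test hU one_le_two (hg.sub hg') ?_
  · filter_upwards [this] with p hp using sub_eq_zero.1 hp
  · intro φ hφ hφc hφs
    have hφ2 : MemLp φ 2 (volume.restrict U) := memLp_of_test hφ.continuous hφc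
    simp only [Pi.sub_apply, sub_mul]
    rw [integral_sub (integrable_mul_of_memLp_two hg hφ2) (integrable_mul_of_memLp_two hg' hφ2)]
    have h1 := h φ hφ hφc hφs
    have h2 := h' φ hφ hφc hφs
    linarith

theorem weakDeriv_ae_eq {U : Set (Space n × ℝ)} (hU : IsOpen U)
    {u g : Space n × ℝ → ℝ} {e : Space n × ℝ}
    (hg : MemLp g 2 (volume.restrict U)) (h : HasWeakDeriv U u g e) :
    weakDeriv U u e =ᵐ[volume.restrict U] g := by
  have := Classical.epsilon_spec (p := fun g => MemLp g 2 (volume.restrict U) ∧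
    HasWeakDeriv U u g e) ⟨g, hg, h⟩
  exact this.2.unique hU this.1 hg h

theorem contDiff_slice_time {Φ : Space n × ℝ → ℝ} (hΦ : ContDiff ℝ (⊤ : ℕ∞) Φ) (x : Space n) :
    ContDiff ℝ (⊤ : ℕ∞) fun t => Φ (x, t) := hΦ.comp (by fun_prop)

theorem deriv_slice_time {Φ : Space n × ℝ → ℝ} (hΦ : ContDiff ℝ (⊤ : ℕ∞) Φ) (x : Space n)
    (t : ℝ) : deriv (fun t => Φ (x, t)) t = fderiv ℝ Φ (x, t) (dirT n) := by
  have h1 : HasFDerivAt Φ (fderiv ℝ Φ (x, t)) (x, t) :=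
    (hΦ.differentiable (by simp) (x, t)).hasFDerivAt
  have h2 : HasDerivAt (fun t : ℝ => (x, t)) ((0 : Space n), (1 : ℝ)) t :=
    (hasDerivAt_const t x).prodMk (hasDerivAt_id t)
  exact (h1.comp_hasDerivAt t h2).deriv

theorem fderiv_slice_space {Φ : Space n × ℝ → ℝ} (hΦ : ContDiff ℝ (⊤ : ℕ∞) Φ) (x : Space n)
    (t : ℝ) (i : Fin n) :
    fderiv ℝ (fun x => Φ (x, t)) x (EuclideanSpace.single i 1) =
      fderiv ℝ Φ (x, t) (dirX i) := by
  have h1 : HasFDerivAt Φ (fderiv ℝ Φ (x, t)) (x, t) :=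
    (hΦ.differentiable (by simp) (x, t)).hasFDerivAt
  have h2 : HasFDerivAt (fun x : Space n => (x, t))
      ((ContinuousLinearMap.id ℝ (Space n)).prod 0) x :=
    (hasFDerivAt_id x).prodMk (hasFDerivAt_const t x)
  have h3 : fderiv ℝ (fun x => Φ (x, t)) x = _ := (h1.comp x h2).fderiv
  rw [h3]
  rfl

theorem slice_eq_zero {Φ : Space n × ℝ → ℝ} (hΦs : tsupport Φ ⊆ cyl Ω T) (x : Space n)
    {t : ℝ} (ht : t ∉ Ioo 0 T) : Φ (x, t) = 0 :=
  image_eq_zero_of_notMem_tsupport fun h => ht (hΦs h).2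

/-- The boundary terms of the integration by parts in time vanish since the test function vanishes
at `t = 0` and `t = T`, whatever the base point `s` of the primitive. -/
theorem hasWeakDeriv_dirT_timePrimitive {s : ℝ} (hs : s ∈ Icc 0 T) {k : Space n × ℝ → ℝ}
    (hk : MemLp k 2 (volume.restrict (cyl Ω T))) :
    HasWeakDeriv (cyl Ω T) (timePrimitive s k) k (dirT n) := by
  intro Φ hΦ hΦc hΦs
  have hT : 0 ≤ T := hs.1.trans hs.2
  rw [integral_cyl _ (integrable_mul_of_memLp_two (memLp_timePrimitive hs hk)
      (memLp_fderiv_of_test hΦ hΦc _)),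
    integral_cyl _ (integrable_mul_of_memLp_two hk (memLp_of_test hΦ.continuous hΦc)),
    ← integral_neg]
  refine integral_congr_ae ?_
  filter_upwards [memLp_slice_time hk] with x hx
  simp only [timePrimitive, ← deriv_slice_time hΦ]
  rw [integral_Ioo_eq_intervalIntegral hT, integral_Ioo_eq_intervalIntegral hT,
    integral_primitive_mul_deriv (intervalIntegrable_of_memLp hx ⟨le_rfl, hT⟩ ⟨hT, le_rfl⟩)
      (by rwa [uIcc_of_le hT]) ((contDiff_slice_time hΦ x).of_le (by simp)),
    slice_eq_zero hΦs x (by simp), slice_eq_zero hΦs x (by simp)]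
  ring

theorem memLp_fst {φ : Space n → ℝ} (hφ : MemLp φ 2 (volume.restrict Ω)) :
    MemLp (fun p : Space n × ℝ => φ p.1) 2 (volume.restrict (cyl Ω T)) := by
  refine (memLp_two_iff_integrable_sq ?_).2 (integrable_fst_of_integrable_cyl hφ.integrable_sq)
  rw [restrict_cyl]
  exact hφ.1.comp_fst

theorem integral_intervalIntegral_swap {H : Space n × ℝ → ℝ}
    (hH : Integrable H (volume.restrict (cyl Ω T))) {a b : ℝ} (ha : a ∈ Icc 0 T)
    (hb : b ∈ Icc 0 T) :
    ∫ x in Ω, ∫ r in a..b, H (x, r) = ∫ r in a..b, ∫ x in Ω, H (x, r) := by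
  refine (intervalIntegral_integral_swap (f := fun r x => H (x, r)) ?_).symm
  rw [restrict_cyl, restrict_Ioo_eq_restrict_Icc] at hH
  refine hH.swap.mono_measure (Measure.prod_mono ?_ le_rfl)
  exact Measure.restrict_mono (uIoc_subset_uIcc.trans (uIcc_subset_Icc ha hb)) le_rfl

theorem tsupport_mul_prod_subset {φ : Space n → ℝ} {η : ℝ → ℝ} :
    tsupport (fun p : Space n × ℝ => φ p.1 * η p.2) ⊆ tsupport φ ×ˢ tsupport η := by
  refine closure_minimal (fun p hp => ?_)
    ((isClosed_tsupport φ).prod (isClosed_tsupport η))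
  exact ⟨subset_tsupport _ (left_ne_zero_of_mul hp), subset_tsupport _ (right_ne_zero_of_mul hp)⟩

theorem hasCompactSupport_mul_prod {φ : Space n → ℝ} {η : ℝ → ℝ} (hφ : HasCompactSupport φ)
    (hη : HasCompactSupport η) :
    HasCompactSupport (fun p : Space n × ℝ => φ p.1 * η p.2) :=
  (hφ.prod hη).of_isClosed_subset (isClosed_tsupport _) tsupport_mul_prod_subset

/-- A spatial weak derivative on the cylinder is one on almost every time slice. The exceptional
null set may depend on the test function, which is harmless since the identity is only integrated
in time for a fixed test function. -/
theorem integral_slice_weakDeriv {v q : Space n × ℝ → ℝ}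
    (hv : MemLp v 2 (volume.restrict (cyl Ω T))) (hq : MemLp q 2 (volume.restrict (cyl Ω T)))
    {i : Fin n} (h : HasWeakDeriv (cyl Ω T) v q (dirX i)) {φ : Space n → ℝ}
    (hφ : ContDiff ℝ (⊤ : ℕ∞) φ) (hφc : HasCompactSupport φ) (hφs : tsupport φ ⊆ Ω) :
    ∀ᵐ t ∂(volume.restrict (Ioo 0 T)),
      ∫ x in Ω, v (x, t) * fderiv ℝ φ x (EuclideanSpace.single i 1) =
        -∫ x in Ω, q (x, t) * φ x := by
  have i1 : Integrable (fun p : Space n × ℝ =>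
      v p * fderiv ℝ φ p.1 (EuclideanSpace.single i 1)) (volume.restrict (cyl Ω T)) :=
    integrable_mul_of_memLp_two hv (memLp_fst (memLp_fderiv_of_test hφ hφc _))
  have i2 : Integrable (fun p : Space n × ℝ => q p * φ p.1) (volume.restrict (cyl Ω T)) :=
    integrable_mul_of_memLp_two hq (memLp_fst (memLp_of_test hφ.continuous hφc))
  have i3 := i1.add i2
  have i3' := i3
  rw [restrict_cyl] at i3'
  have hD := i3'.integral_prod_right
  have key := ae_eq_zero_of_forall_test isOpen_Ioo le_rfl (memLp_one_iff_integrable.2 hD) ?_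
  · have j1 := i1
    have j2 := i2
    rw [restrict_cyl] at j1 j2
    filter_upwards [key, j1.prod_left_ae, j2.prod_left_ae] with t ht h1 h2
    simp only [Pi.add_apply, Pi.zero_apply] at ht
    rw [integral_add h1 h2] at ht
    linarith
  intro η hη hηc hηs
  have hφη : ContDiff ℝ (⊤ : ℕ∞) (fun p : Space n × ℝ => φ p.1 * η p.2) := by fun_prop
  have h1 := h _ hφη (hasCompactSupport_mul_prod hφc hηc)
    (tsupport_mul_prod_subset.trans (prod_mono hφs hηs))
  have hd : ∀ p : Space n × ℝ, fderiv ℝ (fun p : Space n × ℝ => φ p.1 * η p.2) p (dirX i) =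
      fderiv ℝ φ p.1 (EuclideanSpace.single i 1) * η p.2 := by
    rintro ⟨x, t⟩
    rw [← fderiv_slice_space hφη]
    simp only
    rw [fderiv_mul_const (hφ.differentiable (by simp) x)]
    simp [mul_comm]
  obtain ⟨C, hC⟩ := hηc.exists_bound_of_continuous hη.continuous
  have hηm : AEStronglyMeasurable (fun p : Space n × ℝ => η p.2) (volume.restrict (cyl Ω T)) :=
    (hη.continuous.comp continuous_snd).aestronglyMeasurable
  have hηb : ∀ᵐ p ∂(volume.restrict (cyl Ω T)), ‖η p.2‖ ≤ C :=
    Filter.Eventually.of_forall fun p => hC p.2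
  have k1 := i1.mul_bdd hηm hηb
  have k2 := i2.mul_bdd hηm hηb
  have k3 := i3.mul_bdd hηm hηb
  calc _ = ∫ t in Ioo 0 T, ∫ x in Ω,
        (v (x, t) * fderiv ℝ φ x (EuclideanSpace.single i 1) + q (x, t) * φ x) * η t := by
        simp only [integral_mul_const]; rfl
    _ = ∫ p in cyl Ω T, (v p * fderiv ℝ φ p.1 (EuclideanSpace.single i 1) + q p * φ p.1) * η p.2 :=
        (integral_cyl_symm _ k3).symm
    _ = (∫ p in cyl Ω T, v p * fderiv ℝ φ p.1 (EuclideanSpace.single i 1) * η p.2) +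
        ∫ p in cyl Ω T, q p * φ p.1 * η p.2 := by
        rw [← integral_add k1 k2]; simp only [add_mul]
    _ = 0 := by
        simp only [hd, ← mul_assoc] at h1
        rw [h1]; ring

/-- Spatial weak derivatives commute with primitives in time. Passing through the time slices avoids
test functions on the cylinder that are primitives in time, whose support could reach its bottom or
top. -/
theorem hasWeakDeriv_dirX_timePrimitive {s : ℝ} (hs : s ∈ Icc 0 T) {v q : Space n × ℝ → ℝ}
    (hv : MemLp v 2 (volume.restrict (cyl Ω T))) (hq : MemLp q 2 (volume.restrict (cyl Ω T)))
    {i : Fin n} (h : HasWeakDeriv (cyl Ω T) v q (dirX i)) :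
    HasWeakDeriv (cyl Ω T) (timePrimitive s v) (timePrimitive s q) (dirX i) := by
  intro Φ hΦ hΦc hΦs
  rw [integral_cyl_symm _
      (integrable_mul_of_memLp_two (memLp_timePrimitive hs hv) (memLp_fderiv_of_test hΦ hΦc _)),
    integral_cyl_symm _
      (integrable_mul_of_memLp_two (memLp_timePrimitive hs hq) (memLp_of_test hΦ.continuous hΦc)),
    ← integral_neg]
  refine setIntegral_congr_fun measurableSet_Ioo fun t ht => ?_
  have ht' := Ioo_subset_Icc_self ht
  set φ : Space n → ℝ := fun x => Φ (x, t) with hφdef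
  have hφ : ContDiff ℝ (⊤ : ℕ∞) φ := hΦ.comp (by fun_prop)
  have hφs : tsupport φ ⊆ (fun x => (x, t)) ⁻¹' tsupport Φ :=
    tsupport_comp_subset_preimage Φ (by fun_prop)
  have hφc : HasCompactSupport φ :=
    (hΦc.isCompact.image continuous_fst).of_isClosed_subset (isClosed_tsupport φ)
      fun x hx => ⟨(x, t), hφs hx, rfl⟩
  have hφΩ : tsupport φ ⊆ Ω := fun x hx => (hΦs (hφs hx)).1
  simp only [timePrimitive, ← fderiv_slice_space hΦ, ← intervalIntegral.integral_mul_const]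
  have e1 := integral_intervalIntegral_swap
    (H := fun p => v p * fderiv ℝ φ p.1 (EuclideanSpace.single i 1))
    (integrable_mul_of_memLp_two hv (memLp_fst (memLp_fderiv_of_test hφ hφc _))) hs ht'
  have e2 := integral_intervalIntegral_swap (H := fun p => q p * φ p.1)
    (integrable_mul_of_memLp_two hq (memLp_fst (memLp_of_test hφ.continuous hφc))) hs ht'
  refine e1.trans (Eq.trans ?_ (congrArg Neg.neg e2.symm))
  rw [← intervalIntegral.integral_neg]
  exact intervalIntegral_congr_Ioo (integral_slice_weakDeriv hv hq h hφ hφc hφΩ) hs ht'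

theorem HasWeakDeriv.mul_time {U : Set (Space n × ℝ)} {v q : Space n × ℝ → ℝ} {i : Fin n}
    (h : HasWeakDeriv U v q (dirX i)) {c : ℝ → ℝ} (hc : ContDiff ℝ (⊤ : ℕ∞) c) :
    HasWeakDeriv U (fun p => c p.2 * v p) (fun p => c p.2 * q p) (dirX i) := by
  intro Φ hΦ hΦc hΦs
  have hΨ : ContDiff ℝ (⊤ : ℕ∞) (fun p : Space n × ℝ => c p.2 * Φ p) := by fun_prop
  have h1 := h _ hΨ hΦc.mul_left ((tsupport_mul_subset_right).trans hΦs)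
  have hd : ∀ p : Space n × ℝ, fderiv ℝ (fun p : Space n × ℝ => c p.2 * Φ p) p (dirX i) =
      c p.2 * fderiv ℝ Φ p (dirX i) := by
    rintro ⟨x, t⟩
    rw [← fderiv_slice_space hΨ, ← fderiv_slice_space hΦ]
    simp only
    have hs : ContDiff ℝ (⊤ : ℕ∞) fun x : Space n => Φ (x, t) := hΦ.comp (by fun_prop)
    rw [fderiv_const_mul (hs.differentiable (by simp) x)]
    simp
  simp only [hd] at h1
  calc _ = ∫ p in U, v p * (c p.2 * fderiv ℝ Φ p (dirX i)) := by
        congr 1; ext p; ring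
    _ = _ := h1
    _ = _ := by
        congr 2; ext p; ring

/-! ### Vanishing traces and primitives in time -/

theorem inner_L2_eq_integral {α : Type*} [MeasurableSpace α] {μ : Measure α} (u v : Lp ℝ 2 μ) :
    inner ℝ u v = ∫ x, u x * v x ∂μ := by
  rw [L2.inner_def]
  simp [mul_comm]

theorem norm_sq_L2_eq_integral {α : Type*} [MeasurableSpace α] {μ : Measure α} (u : Lp ℝ 2 μ) :
    ‖u‖ ^ 2 = ∫ x, u x ^ 2 ∂μ := by
  rw [← real_inner_self_eq_norm_sq, inner_L2_eq_integral]
  simp only [sq]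

theorem TraceZero.congr {s : ℝ} {u u' : Space n × ℝ → ℝ} (h : TraceZero Ω T s u)
    (hu : u =ᵐ[volume.restrict (cyl Ω T)] u') : TraceZero Ω T s u' := by
  obtain ⟨w, hw, hwu, hs⟩ := h
  refine ⟨w, hw, ?_, hs⟩
  filter_upwards [hwu, ae_ae_swap_of_ae_cyl hu] with t h1 h2
  exact (Filter.EventuallyEq.symm h2).trans h1

/-- Tested against a fixed `φ ∈ C_c^∞(Ω)`, the continuous representative `w` of `v` is a continuous
function of time with weak derivative `∫ k φ` that vanishes at `s`; so it is a primitive. -/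
theorem integral_test_eq_of_traceZero (hT : 0 < T) {s : ℝ} (hs : s ∈ Icc 0 T)
    {v k : Space n × ℝ → ℝ} (hv : MemLp v 2 (volume.restrict (cyl Ω T)))
    (hk : MemLp k 2 (volume.restrict (cyl Ω T))) (hd : HasWeakDeriv (cyl Ω T) v k (dirT n))
    {w : ℝ → L2Space Ω} (hw : ContinuousOn w (Icc 0 T))
    (hwv : ∀ᵐ t ∂(volume.restrict (Ioo 0 T)), (fun x => v (x, t)) =ᵐ[volume.restrict Ω] w t)
    (hws : w s = 0) {φ : Space n → ℝ} (hφ : ContDiff ℝ (⊤ : ℕ∞) φ) (hφc : HasCompactSupport φ)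
    (hφs : tsupport φ ⊆ Ω) {t : ℝ} (ht : t ∈ Icc 0 T) :
    ∫ x in Ω, w t x * φ x = ∫ x in Ω, timePrimitive s k (x, t) * φ x := by
  have hφ2 : MemLp φ 2 (volume.restrict Ω) := memLp_of_test hφ.continuous hφc
  have hφQ : MemLp (fun p : Space n × ℝ => φ p.1) 2 (volume.restrict (cyl Ω T)) := memLp_fst hφ2
  have ik : Integrable (fun p : Space n × ℝ => k p * φ p.1) (volume.restrict (cyl Ω T)) :=
    integrable_mul_of_memLp_two hk hφQ
  have iv : Integrable (fun p : Space n × ℝ => v p * φ p.1) (volume.restrict (cyl Ω T)) :=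
    integrable_mul_of_memLp_two hv hφQ
  let m : ℝ → ℝ := fun t => ∫ x in Ω, w t x * φ x
  have hm : m = fun t => inner ℝ (w t) (hφ2.toLp φ) := by
    ext t
    rw [inner_L2_eq_integral]
    exact integral_congr_ae (by filter_upwards [hφ2.coeFn_toLp] with x hx using by rw [hx])
  have hmc : ContinuousOn m (Icc 0 T) := by
    rw [hm]
    exact hw.inner continuousOn_const
  let κ : ℝ → ℝ := fun t => ∫ x in Ω, k (x, t) * φ x
  have hκ : IntegrableOn κ (Ioo 0 T) := by
    have := ik
    rw [restrict_cyl] at this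
    exact this.integral_prod_right
  have h0 : (0 : ℝ) ∈ Icc 0 T := ⟨le_rfl, hT.le⟩
  have h1 : T ∈ Icc 0 T := ⟨hT.le, le_rfl⟩
  have hκi := intervalIntegrable_of_integrableOn_Ioo hκ h0 h1
  have hs' : s ∈ uIcc 0 T := by rwa [uIcc_of_le hT.le]
  have hKc : ContinuousOn (fun t => ∫ r in s..t, κ r) (Icc 0 T) := by
    rw [← uIcc_of_le hT.le]
    exact (hκi.absolutelyContinuousOnInterval_intervalIntegral hs').continuousOn
  let d : ℝ → ℝ := fun t => m t - ∫ r in s..t, κ r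
  have hdc : ContinuousOn d (Icc 0 T) := hmc.sub hKc
  have hmulη : ∀ {f : ℝ → ℝ}, ContinuousOn f (Icc 0 T) → ∀ {η : ℝ → ℝ}, Continuous η →
      IntegrableOn (fun t => f t * η t) (Ioo 0 T) := fun hf _ hη =>
    ((hf.mul hη.continuousOn).integrableOn_compact isCompact_Icc).mono_set Ioo_subset_Icc_self
  obtain ⟨c, hc⟩ := exists_ae_eq_const_of_integral_mul_deriv_eq_zero hT
    ((hdc.integrableOn_compact isCompact_Icc).mono_set Ioo_subset_Icc_self) (by
    intro η hη hηc hηs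
    have hη' : Continuous (deriv η) := hη.continuous_deriv (by simp)
    have hφη : ContDiff ℝ (⊤ : ℕ∞) (fun p : Space n × ℝ => φ p.1 * η p.2) := by fun_prop
    have e := hd _ hφη (hasCompactSupport_mul_prod hφc hηc)
      (tsupport_mul_prod_subset.trans (prod_mono hφs hηs))
    have hfd : ∀ p : Space n × ℝ, fderiv ℝ (fun p : Space n × ℝ => φ p.1 * η p.2) p (dirT n) =
        φ p.1 * deriv η p.2 := by
      rintro ⟨x, t⟩
      rw [← deriv_slice_time hφη]
      simp
    simp only [hfd, ← mul_assoc] at e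
    obtain ⟨C, hC⟩ := hηc.exists_bound_of_continuous hη.continuous
    obtain ⟨C', hC'⟩ := hηc.deriv.exists_bound_of_continuous hη'
    have e1 := integral_cyl_symm _ (iv.mul_bdd (g := fun p => deriv η p.2)
      (hη'.comp continuous_snd).aestronglyMeasurable
      (Filter.Eventually.of_forall fun p => hC' p.2))
    have e2 := integral_cyl_symm _ (ik.mul_bdd (g := fun p => η p.2)
      (hη.continuous.comp continuous_snd).aestronglyMeasurable
      (Filter.Eventually.of_forall fun p => hC p.2))
    simp only [integral_mul_const] at e1 e2
    have e3 : ∫ t in Ioo 0 T, m t * deriv η t =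
        ∫ t in Ioo 0 T, (∫ x in Ω, v (x, t) * φ x) * deriv η t := by
      refine integral_congr_ae ?_
      filter_upwards [hwv] with t ht
      simp only [m]
      congr 1
      exact integral_congr_ae (by filter_upwards [ht] with x hx using by rw [← hx])
    have e4 := integral_primitive_mul_deriv hκi hs' (hη.of_le (by simp : (1 : WithTop ℕ∞) ≤ _))
    have hη0 : η 0 = 0 := image_eq_zero_of_notMem_tsupport fun h => by simpa using hηs h
    have hηT : η T = 0 := image_eq_zero_of_notMem_tsupport fun h => by simpa using hηs h
    rw [hη0, hηT, ← integral_Ioo_eq_intervalIntegral hT.le,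
      ← integral_Ioo_eq_intervalIntegral hT.le] at e4
    simp only [d, sub_mul]
    rw [integral_sub (hmulη hmc hη') (hmulη hKc hη'), e3, ← e1, e, e2, e4]
    simp [κ])
  have hdconst : EqOn d (fun _ => c) (Icc 0 T) := by
    refine Measure.eqOn_Icc_of_ae_eq volume hT.ne ?_ hdc continuousOn_const
    rwa [restrict_Ioo_eq_restrict_Icc] at hc
  have hds : d s = 0 := by
    simp only [d, intervalIntegral.integral_same, sub_zero, hm, hws, inner_zero_left]
  have hdt : d t = 0 := by
    rw [hdconst ht, ← hds, hdconst hs]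
  have := integral_intervalIntegral_swap ik hs ht
  simp only [intervalIntegral.integral_mul_const] at this
  have hfin : m t = ∫ r in s..t, κ r := sub_eq_zero.1 hdt
  exact hfin.trans this.symm

/-- A function with vanishing trace at time `s` is the primitive of its weak time derivative. -/
theorem ae_eq_timePrimitive_of_traceZero (hΩ : IsOpen Ω) (hT : 0 < T) {s : ℝ}
    (hs : s ∈ Icc 0 T) {v k : Space n × ℝ → ℝ} (hv : MemLp v 2 (volume.restrict (cyl Ω T)))
    (hk : MemLp k 2 (volume.restrict (cyl Ω T))) (hd : HasWeakDeriv (cyl Ω T) v k (dirT n))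
    (htr : TraceZero Ω T s v) : v =ᵐ[volume.restrict (cyl Ω T)] timePrimitive s k := by
  obtain ⟨w, hw, hwv, hws⟩ := htr
  have hP := memLp_timePrimitive hs hk
  have hslice : ∀ᵐ t ∂(volume.restrict (Ioo 0 T)), ∀ᵐ x ∂(volume.restrict Ω),
      v (x, t) = timePrimitive s k (x, t) := by
    filter_upwards [hwv, memLp_slice_space hP, ae_restrict_mem measurableSet_Ioo] with t h1 h2 ht
    have := ae_eq_zero_of_forall_test hΩ one_le_two ((Lp.memLp (w t)).sub h2)
      fun φ hφ hφc hφs => by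
        have hφ2 : MemLp φ 2 (volume.restrict Ω) := memLp_of_test hφ.continuous hφc
        simp only [Pi.sub_apply, sub_mul]
        rw [integral_sub (integrable_mul_of_memLp_two (Lp.memLp (w t)) hφ2)
          (integrable_mul_of_memLp_two h2 hφ2), sub_eq_zero]
        exact integral_test_eq_of_traceZero hT hs hv hk hd hw hwv hws hφ hφc hφs
          (Ioo_subset_Icc_self ht)
    filter_upwards [h1, this] with x hx1 hx2
    rw [hx1]
    exact sub_eq_zero.1 hx2
  have hi : Integrable (fun p => (v p - timePrimitive s k p) ^ 2) (volume.restrict (cyl Ω T)) :=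
    (hv.sub hP).integrable_sq
  have hz : ∫ p in cyl Ω T, (v p - timePrimitive s k p) ^ 2 = 0 := by
    rw [integral_cyl_symm _ hi]
    refine integral_eq_zero_of_ae ?_
    filter_upwards [hslice] with t ht
    refine integral_eq_zero_of_ae ?_
    filter_upwards [ht] with x hx
    simp [hx]
  rw [integral_eq_zero_iff_of_nonneg (fun p => sq_nonneg _) hi] at hz
  filter_upwards [hz] with p hp
  exact sub_eq_zero.1 (pow_eq_zero_iff two_ne_zero |>.1 hp)

theorem traceZero_timePrimitive {s : ℝ} (hs : s ∈ Icc 0 T) {k : Space n × ℝ → ℝ}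
    (hk : MemLp k 2 (volume.restrict (cyl Ω T))) : TraceZero Ω T s (timePrimitive s k) := by
  wlog hm : StronglyMeasurable k generalizing k
  · exact (this ((memLp_congr_ae hk.1.ae_eq_mk).1 hk) hk.1.stronglyMeasurable_mk).congr
      (timePrimitive_congr hs hk.1.ae_eq_mk.symm)
  set u := timePrimitive s k with hu
  have hum : StronglyMeasurable u := stronglyMeasurable_timePrimitive s hm
  set N := ∫ p in cyl Ω T, k p ^ 2 with hN
  have hslice : ∀ t, AEStronglyMeasurable (fun x => u (x, t)) (volume.restrict Ω) := fun t =>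
    (hum.comp_measurable measurable_prodMk_right).aestronglyMeasurable
  have hsq : ∀ t ∈ Icc 0 T, ∀ t' ∈ Icc 0 T, ∀ᵐ x ∂(volume.restrict Ω),
      (u (x, t) - u (x, t')) ^ 2 ≤ |t - t'| * ∫ r in Ioo 0 T, k (x, r) ^ 2 := by
    intro t ht t' ht'
    filter_upwards [memLp_slice_time hk] with x hx
    have : u (x, t) - u (x, t') = ∫ r in t'..t, k (x, r) :=
      intervalIntegral.integral_interval_sub_left (intervalIntegrable_of_memLp hx hs ht)
        (intervalIntegrable_of_memLp hx hs ht')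
    rw [this]
    exact sq_integral_le_mul_integral_sq hx ht' ht
  have hdiff : ∀ t ∈ Icc 0 T, ∀ t' ∈ Icc 0 T,
      MemLp (fun x => u (x, t) - u (x, t')) 2 (volume.restrict Ω) := by
    intro t ht t' ht'
    have hm := (hslice t).sub (hslice t')
    refine (memLp_two_iff_integrable_sq hm).2 ?_
    refine ((integrable_integral_sq hk).const_mul |t - t'|).mono' (hm.pow 2) ?_
    filter_upwards [hsq t ht t' ht'] with x hx
    rwa [Real.norm_of_nonneg (sq_nonneg _)]
  have hmem : ∀ t ∈ Icc 0 T, MemLp (fun x => u (x, t)) 2 (volume.restrict Ω) := by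
    intro t ht
    have := hdiff t ht s hs
    simpa [hu, timePrimitive] using this
  have hint : ∀ t ∈ Icc 0 T, ∀ t' ∈ Icc 0 T,
      ∫ x in Ω, (u (x, t) - u (x, t')) ^ 2 ≤ |t - t'| * N := by
    intro t ht t' ht'
    refine (integral_mono_ae (hdiff t ht t' ht').integrable_sq
      ((integrable_integral_sq hk).const_mul _) (hsq t ht t' ht')).trans_eq ?_
    rw [integral_const_mul, hN, integral_cyl _ hk.integrable_sq]
  classical
  let w : ℝ → L2Space Ω := fun t =>
    if h : MemLp (fun x => u (x, t)) 2 (volume.restrict Ω) then h.toLp _ else 0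
  have hw : ∀ t ∈ Icc 0 T, w t =ᵐ[volume.restrict Ω] fun x => u (x, t) := by
    intro t ht
    simp only [w, hmem t ht, dif_pos]
    exact (hmem t ht).coeFn_toLp
  refine ⟨w, ?_, ?_, ?_⟩
  · intro t₀ ht₀
    refine tendsto_iff_dist_tendsto_zero.2 ?_
    refine squeeze_zero' (g := fun t => Real.sqrt (|t - t₀| * N))
      (Filter.Eventually.of_forall fun _ => dist_nonneg) ?_ ?_
    · filter_upwards [self_mem_nhdsWithin] with t ht
      refine Real.le_sqrt_of_sq_le ?_
      rw [dist_eq_norm, norm_sq_L2_eq_integral]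
      refine le_trans (le_of_eq (integral_congr_ae ?_)) (hint t ht t₀ ht₀)
      filter_upwards [Lp.coeFn_sub (w t) (w t₀), hw t ht, hw t₀ ht₀] with x h1 h2 h3
      rw [h1, Pi.sub_apply, h2, h3]
    · have : Continuous fun t => Real.sqrt (|t - t₀| * N) := by fun_prop
      have h := (this.tendsto t₀).mono_left (nhdsWithin_le_nhds (s := Icc 0 T))
      simpa using h
  · filter_upwards [ae_restrict_mem measurableSet_Ioo] with t ht
    exact (hw t (Ioo_subset_Icc_self ht)).symm
  · refine Lp.ext ?_
    filter_upwards [hw s hs, Lp.coeFn_zero ℝ 2 (volume.restrict Ω)] with x h1 h2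
    rw [h1, h2]
    simp [hu, timePrimitive]

/-! ### Lions' theorem and the space of gradients -/

/-- Lions' variant of the Lax-Milgram theorem. The form `⟪u, K w⟫` is not coercive on a single
space; instead each test vector `w` is paired with some `z ∈ V` (not assumed to depend linearly on
`w`) on which the form controls `‖z‖²`, while `‖z‖` controls `L w`. Hence `L` is bounded with
respect to the norm of the projection of `K w` to `V`, and the theorems of Hahn-Banach and Riesz
apply. -/
theorem exists_mem_forall_inner_eq {H W : Type*} [NormedAddCommGroup H] [InnerProductSpace ℝ H]
    [CompleteSpace H] [AddCommGroup W] [Module ℝ W] (V : Submodule ℝ H)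
    (hV : IsClosed (V : Set H)) (K : W →ₗ[ℝ] H) (L : W →ₗ[ℝ] ℝ) {c C : ℝ} (hc : 0 < c)
    (hC : 0 ≤ C)
    (h : ∀ w, ∃ z ∈ V, c * ‖z‖ ^ 2 ≤ |inner ℝ z (K w)| ∧ |L w| ≤ C * ‖z‖) :
    ∃ u ∈ V, ∀ w, inner ℝ u (K w) = L w := by
  have : CompleteSpace V := hV.completeSpace_coe
  let K' : W →ₗ[ℝ] V := V.orthogonalProjectionOnto.toLinearMap ∘ₗ K
  have hK' : ∀ (z : V) (w : W), inner ℝ (z : H) (K w) = inner ℝ z (K' w) := fun z w =>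
    (Submodule.inner_orthogonalProjectionOnto_eq_of_mem_left z (K w)).symm
  have hbound : ∀ w, |L w| ≤ C / c * ‖K' w‖ := by
    intro w
    obtain ⟨z, hz, h1, h2⟩ := h w
    have h3 : c * ‖z‖ ≤ ‖K' w‖ := by
      rw [hK' ⟨z, hz⟩ w] at h1
      have h4 := h1.trans (abs_real_inner_le_norm _ _)
      rw [Submodule.coe_norm] at h4
      rcases (norm_nonneg z).eq_or_lt with h0 | h0
      · rw [← h0, mul_zero]; exact norm_nonneg _
      · refine le_of_mul_le_mul_right ?_ h0
        simp only at h4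
        linarith
    refine h2.trans ?_
    rw [div_mul_eq_mul_div, le_div_iff₀ hc, mul_assoc, mul_comm ‖z‖]
    exact mul_le_mul_of_nonneg_left h3 hC
  have hker : LinearMap.ker K' ≤ LinearMap.ker L := by
    intro w hw
    have := hbound w
    rw [LinearMap.mem_ker.1 hw, norm_zero, mul_zero] at this
    exact abs_nonpos_iff.1 this
  let f : LinearMap.range K' →ₗ[ℝ] ℝ :=
    (LinearMap.ker K').liftQ L hker ∘ₗ K'.quotKerEquivRange.symm.toLinearMap
  have hf : ∀ w, f ⟨K' w, LinearMap.mem_range_self K' w⟩ = L w := by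
    intro w
    simp only [f, LinearMap.comp_apply, LinearEquiv.coe_coe]
    rw [LinearMap.quotKerEquivRange_symm_apply_image, Submodule.mkQ_apply, Submodule.liftQ_apply]
  let F : StrongDual ℝ (LinearMap.range K') := f.mkContinuous (C / c) (by
    rintro ⟨_, w, rfl⟩
    rw [hf]
    exact hbound w)
  obtain ⟨G, hG, -⟩ := exists_extension_norm_eq (LinearMap.range K') F
  refine ⟨((InnerProductSpace.toDual ℝ V).symm G : V), Submodule.coe_mem _, fun w => ?_⟩
  rw [hK', InnerProductSpace.toDual_symm_apply,
    hG ⟨K' w, LinearMap.mem_range_self K' w⟩]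
  exact hf w

theorem timePrimitive_add {s : ℝ} (hs : s ∈ Icc 0 T) {h k : Space n × ℝ → ℝ}
    (hh : MemLp h 2 (volume.restrict (cyl Ω T))) (hk : MemLp k 2 (volume.restrict (cyl Ω T))) :
    timePrimitive s (h + k) =ᵐ[volume.restrict (cyl Ω T)]
      timePrimitive s h + timePrimitive s k := by
  filter_upwards [ae_cyl_of_ae_fst (T := T) (memLp_slice_time hh),
    ae_cyl_of_ae_fst (T := T) (memLp_slice_time hk), ae_cyl_snd_mem Ω T] with p h1 h2 h3
  exact intervalIntegral.integral_add
    (intervalIntegrable_of_memLp h1 hs (Ioo_subset_Icc_self h3))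
    (intervalIntegrable_of_memLp h2 hs (Ioo_subset_Icc_self h3))

theorem timePrimitive_smul (s c : ℝ) (h : Space n × ℝ → ℝ) :
    timePrimitive s (c • h) = c • timePrimitive s h := by
  ext p
  exact intervalIntegral.integral_const_mul c _

/-- The primitive in time as a linear map on `L²(Ω × (0,T))`. -/
def timePrimitiveLinear (Ω : Set (Space n)) {s : ℝ} (hs : s ∈ Icc 0 T) :
    L2Cyl Ω T →ₗ[ℝ] L2Cyl Ω T where
  toFun h := (memLp_timePrimitive hs (Lp.memLp h)).toLp _
  map_add' h k := by
    rw [← MemLp.toLp_add]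
    exact MemLp.toLp_congr _ _ ((timePrimitive_congr hs (Lp.coeFn_add h k)).trans
      (timePrimitive_add hs (Lp.memLp h) (Lp.memLp k)))
  map_smul' c h := by
    rw [RingHom.id_apply, ← MemLp.toLp_const_smul]
    refine MemLp.toLp_congr _ _ ((timePrimitive_congr hs (Lp.coeFn_smul c h)).trans ?_)
    rw [timePrimitive_smul]

theorem norm_timePrimitiveLinear_le {s : ℝ} (hs : s ∈ Icc 0 T) (h : L2Cyl Ω T) :
    ‖timePrimitiveLinear Ω hs h‖ ≤ T * ‖h‖ := by
  have hT : 0 ≤ T := hs.1.trans hs.2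
  rw [← sq_le_sq₀ (norm_nonneg _) (by positivity), mul_pow, norm_sq_L2_eq_integral,
    norm_sq_L2_eq_integral]
  refine le_trans (le_of_eq (integral_congr_ae ?_))
    (integral_sq_timePrimitive_le hs (Lp.memLp h))
  filter_upwards [(memLp_timePrimitive hs (Lp.memLp h)).coeFn_toLp] with p hp
  exact congrArg (· ^ 2) hp

/-- The primitive in time as a bounded operator on `L²(Ω × (0,T))`. -/
def timePrimitiveL (Ω : Set (Space n)) {s : ℝ} (hs : s ∈ Icc 0 T) : L2Cyl Ω T →L[ℝ] L2Cyl Ω T :=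
  (timePrimitiveLinear Ω hs).mkContinuous T (norm_timePrimitiveLinear_le hs)

theorem coeFn_timePrimitiveL {s : ℝ} (hs : s ∈ Icc 0 T) (h : L2Cyl Ω T) :
    timePrimitiveL Ω hs h =ᵐ[volume.restrict (cyl Ω T)] timePrimitive s h :=
  (memLp_timePrimitive hs (Lp.memLp h)).coeFn_toLp

/-- The Hilbert space `L²(Ω × (0,T))ⁿ⁺¹` of space-time gradients: the component `none` stands for
`∂ₜ`, the component `some i` for the `i`-th spatial derivative. -/
abbrev L2Grad (Ω : Set (Space n)) (T : ℝ) := PiLp 2 fun _ : Option (Fin n) => L2Cyl Ω T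

/-- The functional whose vanishing for all test functions `φ` says that `z (some i)` is the `i`-th
spatial weak derivative of the primitive in time of `z none`. -/
def testFunctional {s : ℝ} (hs : s ∈ Icc 0 T) (i : Fin n) {φ : Space n × ℝ → ℝ}
    (hφ : ContDiff ℝ (⊤ : ℕ∞) φ) (hφc : HasCompactSupport φ) : L2Grad Ω T →L[ℝ] ℝ :=
  (innerSL ℝ ((memLp_fderiv_of_test hφ hφc (dirX i)).toLp _ : L2Cyl Ω T)).comp
      ((timePrimitiveL Ω hs).comp (PiLp.proj 2 _ none)) +
    (innerSL ℝ ((memLp_of_test hφ.continuous hφc).toLp _ : L2Cyl Ω T)).comp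
      (PiLp.proj 2 _ (some i))

theorem testFunctional_apply {s : ℝ} (hs : s ∈ Icc 0 T) (i : Fin n) {φ : Space n × ℝ → ℝ}
    (hφ : ContDiff ℝ (⊤ : ℕ∞) φ) (hφc : HasCompactSupport φ) (z : L2Grad Ω T) :
    testFunctional hs i hφ hφc z =
      (∫ p in cyl Ω T, timePrimitive s (z none) p * fderiv ℝ φ p (dirX i)) +
        ∫ p in cyl Ω T, z (some i) p * φ p := by
  have h1 : inner ℝ ((memLp_fderiv_of_test hφ hφc (dirX i)).toLp _ : L2Cyl Ω T)
      (timePrimitiveL Ω hs (z none)) =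
      ∫ p in cyl Ω T, timePrimitive s (z none) p * fderiv ℝ φ p (dirX i) := by
    rw [inner_L2_eq_integral]
    refine integral_congr_ae ?_
    filter_upwards [coeFn_timePrimitiveL hs (z none),
      (memLp_fderiv_of_test (μ := volume.restrict (cyl Ω T)) hφ hφc (dirX i)).coeFn_toLp]
      with p h1 h2
    rw [h1, h2, mul_comm]
  have h2 : inner ℝ ((memLp_of_test hφ.continuous hφc).toLp _ : L2Cyl Ω T) (z (some i)) =
      ∫ p in cyl Ω T, z (some i) p * φ p := by
    rw [inner_L2_eq_integral]
    refine integral_congr_ae ?_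
    filter_upwards [(memLp_of_test (μ := volume.restrict (cyl Ω T))
      hφ.continuous hφc).coeFn_toLp] with p h1
    rw [h1, mul_comm]
  rw [← h1, ← h2]
  rfl

/-- The space-time gradients of the functions of `H¹(Ω × (0,T))` that vanish at time `s`. Such a
function is `timePrimitive s (z none)`, so only the spatial components are constrained. -/
def gradSpace (Ω : Set (Space n)) {s : ℝ} (hs : s ∈ Icc 0 T) : Submodule ℝ (L2Grad Ω T) :=
  ⨅ (i : Fin n) (φ : Space n × ℝ → ℝ) (hφ : ContDiff ℝ (⊤ : ℕ∞) φ) (hφc : HasCompactSupport φ)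
    (_ : tsupport φ ⊆ cyl Ω T), LinearMap.ker (testFunctional hs i hφ hφc).toLinearMap

theorem isClosed_gradSpace {s : ℝ} (hs : s ∈ Icc 0 T) :
    IsClosed (gradSpace Ω hs : Set (L2Grad Ω T)) := by
  simp only [gradSpace, Submodule.coe_iInf]
  refine isClosed_iInter fun i => isClosed_iInter fun φ => isClosed_iInter fun hφ =>
    isClosed_iInter fun hφc => isClosed_iInter fun _ => ?_
  exact (testFunctional hs i hφ hφc).isClosed_ker

theorem mem_gradSpace {s : ℝ} (hs : s ∈ Icc 0 T) {z : L2Grad Ω T} :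
    z ∈ gradSpace Ω hs ↔
      ∀ i, HasWeakDeriv (cyl Ω T) (timePrimitive s (z none)) (z (some i)) (dirX i) := by
  simp only [gradSpace, Submodule.mem_iInf, LinearMap.mem_ker, ContinuousLinearMap.coe_coe,
    testFunctional_apply, add_eq_zero_iff_eq_neg, HasWeakDeriv]

/-- The change of sign of the time component, which turns the inner product of gradients into
`waveForm`. -/
def timeReflection (Ω : Set (Space n)) (T : ℝ) : L2Grad Ω T →ₗ[ℝ] L2Grad Ω T where
  toFun z := WithLp.toLp 2 fun o => o.elim (-z none) fun i => z (some i)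
  map_add' z w := by
    ext1 o
    cases o <;> simp [add_comm]
  map_smul' c z := by
    ext1 o
    cases o <;> simp

theorem inner_timeReflection (z w : L2Grad Ω T) :
    inner ℝ z (timeReflection Ω T w) =
      -inner ℝ (z none) (w none) + ∑ i, inner ℝ (z (some i)) (w (some i)) := by
  simp [PiLp.inner_apply, timeReflection, Fintype.sum_option]

theorem inner_timeReflection_comm (z w : L2Grad Ω T) :
    inner ℝ z (timeReflection Ω T w) = inner ℝ w (timeReflection Ω T z) := by
  simp only [inner_timeReflection]
  rw [real_inner_comm]
  congr 1
  exact Finset.sum_congr rfl fun i _ => real_inner_comm _ _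

theorem norm_sq_L2Grad (z : L2Grad Ω T) :
    ‖z‖ ^ 2 = ‖z none‖ ^ 2 + ∑ i, ‖z (some i)‖ ^ 2 := by
  rw [PiLp.norm_sq_eq_of_L2, Fintype.sum_option]

/-- `z` is the space-time gradient of `u`. -/
def IsGradient (z : L2Grad Ω T) (u : Space n × ℝ → ℝ) : Prop :=
  HasWeakDeriv (cyl Ω T) u (z none) (dirT n) ∧
    ∀ i, HasWeakDeriv (cyl Ω T) u (z (some i)) (dirX i)

theorem isGradient_timePrimitive {s : ℝ} (hs : s ∈ Icc 0 T) {z : L2Grad Ω T}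
    (hz : z ∈ gradSpace Ω hs) : IsGradient z (timePrimitive s (z none)) :=
  ⟨hasWeakDeriv_dirT_timePrimitive hs (Lp.memLp _), (mem_gradSpace hs).1 hz⟩

theorem memH1_timePrimitive {s : ℝ} (hs : s ∈ Icc 0 T) {z : L2Grad Ω T}
    (hz : z ∈ gradSpace Ω hs) : MemH1 (cyl Ω T) (timePrimitive s (z none)) :=
  ⟨memLp_timePrimitive hs (Lp.memLp _),
    fun i => ⟨_, Lp.memLp (z (some i)), (isGradient_timePrimitive hs hz).2 i⟩,
    ⟨_, Lp.memLp (z none), (isGradient_timePrimitive hs hz).1⟩⟩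

theorem exists_gradient_of_traceZero (hΩ : IsOpen Ω) (hT : 0 < T) {s : ℝ} (hs : s ∈ Icc 0 T)
    {u : Space n × ℝ → ℝ} (hu : MemH1 (cyl Ω T) u) (htr : TraceZero Ω T s u) :
    ∃ z ∈ gradSpace Ω hs, IsGradient z u ∧
      u =ᵐ[volume.restrict (cyl Ω T)] timePrimitive s (z none) := by
  obtain ⟨h1, h2, k, hk, hkd⟩ := hu
  choose q hq hqd using h2
  let z : L2Grad Ω T := WithLp.toLp 2 fun o => o.elim (hk.toLp k) fun i => (hq i).toLp (q i)
  have hz0 : z none =ᵐ[volume.restrict (cyl Ω T)] k := hk.coeFn_toLp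
  have hz1 : ∀ i, z (some i) =ᵐ[volume.restrict (cyl Ω T)] q i := fun i => (hq i).coeFn_toLp
  have hu : u =ᵐ[volume.restrict (cyl Ω T)] timePrimitive s (z none) :=
    (ae_eq_timePrimitive_of_traceZero hΩ hT hs h1 hk hkd htr).trans
      (timePrimitive_congr hs hz0.symm)
  have hg : IsGradient z u := ⟨hkd.congr ae_eq_rfl hz0.symm,
    fun i => (hqd i).congr ae_eq_rfl (hz1 i).symm⟩
  exact ⟨z, (mem_gradSpace hs).2 fun i => (hg.2 i).congr hu ae_eq_rfl, hg, hu⟩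

theorem waveForm_eq_inner (hΩ : IsOpen Ω) {z w : L2Grad Ω T} {u v : Space n × ℝ → ℝ}
    (hz : IsGradient z u) (hw : IsGradient w v) :
    waveForm Ω T u v = inner ℝ z (timeReflection Ω T w) := by
  have hU := isOpen_cyl hΩ T
  rw [inner_timeReflection]
  simp only [inner_L2_eq_integral]
  have hi : ∀ o, Integrable (fun p => z o p * w o p) (volume.restrict (cyl Ω T)) := fun o =>
    integrable_mul_of_memLp_two (Lp.memLp _) (Lp.memLp _)
  rw [← integral_finsetSum _ fun i _ => hi (some i), neg_add_eq_sub,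
    ← integral_sub (integrable_finsetSum _ fun i _ => hi (some i)) (hi none)]
  refine integral_congr_ae ?_
  have e1 := weakDeriv_ae_eq hU (Lp.memLp _) hz.1
  have e2 := weakDeriv_ae_eq hU (Lp.memLp _) hw.1
  have e3 := ae_all_iff.2 fun i => weakDeriv_ae_eq hU (Lp.memLp _) (hz.2 i)
  have e4 := ae_all_iff.2 fun i => weakDeriv_ae_eq hU (Lp.memLp _) (hw.2 i)
  filter_upwards [e1, e2, e3, e4] with p h1 h2 h3 h4
  rw [h1, h2]
  congr 1
  exact Finset.sum_congr rfl fun i _ => by rw [h3, h4]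

/-! ### Coercivity and well-posedness -/

/-- `s` and `s'` are the two ends of `[0,T]`, and `σ` is the direction of time from `s` to `s'`. -/
def OppositeEnds (T s s' σ : ℝ) : Prop :=
  (s = 0 ∧ s' = T ∧ σ = 1) ∨ (s = T ∧ s' = 0 ∧ σ = -1)

theorem OppositeEnds.symm {s s' σ : ℝ} (h : OppositeEnds T s s' σ) :
    OppositeEnds T s' s (-σ) := by
  rcases h with ⟨rfl, rfl, rfl⟩ | ⟨rfl, rfl, rfl⟩
  · exact Or.inr ⟨rfl, rfl, rfl⟩
  · exact Or.inl ⟨rfl, rfl, neg_neg 1⟩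

theorem OppositeEnds.left_mem {s s' σ : ℝ} (h : OppositeEnds T s s' σ) (hT : 0 ≤ T) :
    s ∈ Icc 0 T := by
  rcases h with ⟨rfl, rfl, rfl⟩ | ⟨rfl, rfl, rfl⟩
  · exact ⟨le_rfl, hT⟩
  · exact ⟨hT, le_rfl⟩

theorem OppositeEnds.exp_le {s s' σ : ℝ} (h : OppositeEnds T s s' σ) {t : ℝ}
    (ht : t ∈ Icc 0 T) : Real.exp (σ * t) ≤ Real.exp T := by
  apply Real.exp_le_exp.2
  rcases h with ⟨rfl, rfl, rfl⟩ | ⟨rfl, rfl, rfl⟩ <;> linarith [ht.1, ht.2]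

/-- The boundary term at `s` vanishes, and the one at the other end has the good sign. -/
theorem integral_exp_mul_sq_primitive_le {k : ℝ → ℝ} {s s' σ : ℝ} (hT : 0 ≤ T)
    (hss : OppositeEnds T s s' σ) (hk : IntervalIntegrable k volume 0 T) :
    ∫ t in 0..T, Real.exp (-σ * t) * (∫ r in s..t, k r) ^ 2 ≤
      2 * σ * ∫ t in 0..T, Real.exp (-σ * t) * ((∫ r in s..t, k r) * k t) := by
  have h := two_mul_integral_exp_mul_primitive (-σ) hk
    (by rw [uIcc_of_le hT]; exact hss.left_mem hT)
  rcases hss with ⟨rfl, rfl, rfl⟩ | ⟨rfl, rfl, rfl⟩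
  · rw [intervalIntegral.integral_same] at h
    have : 0 ≤ Real.exp (-1 * s') * (∫ r in 0..s', k r) ^ 2 := by positivity
    linarith
  · rw [intervalIntegral.integral_same] at h
    have : 0 ≤ Real.exp (-(-1) * 0) * (∫ r in s..0, k r) ^ 2 := by positivity
    linarith

theorem memLp_exp_mul {h : Space n × ℝ → ℝ} (σ : ℝ)
    (hh : MemLp h 2 (volume.restrict (cyl Ω T))) :
    MemLp (fun p => Real.exp (σ * p.2) * h p) 2 (volume.restrict (cyl Ω T)) := by
  have hc : Continuous fun p : Space n × ℝ => Real.exp (σ * p.2) := by fun_prop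
  refine MemLp.of_le_mul (c := Real.exp (|σ| * T)) hh (hc.aestronglyMeasurable.mul hh.1) ?_
  filter_upwards [ae_cyl_snd_mem Ω T] with p hp
  rw [norm_mul, Real.norm_of_nonneg (Real.exp_nonneg _)]
  refine mul_le_mul_of_nonneg_right (Real.exp_le_exp.2 ?_) (norm_nonneg _)
  calc σ * p.2 ≤ |σ| * p.2 := mul_le_mul_of_nonneg_right (le_abs_self σ) hp.1.le
    _ ≤ |σ| * T := mul_le_mul_of_nonneg_left hp.2.le (abs_nonneg σ)

theorem integral_exp_mul_sq_timePrimitive_le (hT : 0 ≤ T) {s s' σ : ℝ}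
    (hss : OppositeEnds T s s' σ) {h : Space n × ℝ → ℝ}
    (hh : MemLp h 2 (volume.restrict (cyl Ω T))) :
    ∫ p in cyl Ω T, Real.exp (-σ * p.2) * timePrimitive s h p ^ 2 ≤
      2 * σ * ∫ p in cyl Ω T, Real.exp (-σ * p.2) * (timePrimitive s h p * h p) := by
  have hP := memLp_timePrimitive (hss.left_mem hT) hh
  have i1 : Integrable (fun p => Real.exp (-σ * p.2) * timePrimitive s h p ^ 2)
      (volume.restrict (cyl Ω T)) := by
    refine (integrable_mul_of_memLp_two (memLp_exp_mul (-σ) hP) hP).congr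
      (Filter.Eventually.of_forall fun p => ?_)
    simp only
    ring
  have i2 : Integrable (fun p => Real.exp (-σ * p.2) * (timePrimitive s h p * h p))
      (volume.restrict (cyl Ω T)) := by
    refine (integrable_mul_of_memLp_two (memLp_exp_mul (-σ) hP) hh).congr
      (Filter.Eventually.of_forall fun p => ?_)
    simp only
    ring
  rw [integral_cyl _ i1, integral_cyl _ i2, ← integral_const_mul]
  rw [restrict_cyl] at i1 i2
  refine integral_mono_ae i1.integral_prod_left (i2.integral_prod_left.const_mul _) ?_
  filter_upwards [memLp_slice_time hh] with x hx
  simp only [timePrimitive]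
  rw [integral_Ioo_eq_intervalIntegral hT, integral_Ioo_eq_intervalIntegral hT]
  exact integral_exp_mul_sq_primitive_le hT hss
    (intervalIntegrable_of_memLp hx ⟨le_rfl, hT⟩ ⟨hT, le_rfl⟩)

/-- The coercivity estimate. For `v` with gradient `w` that vanishes at `s'`, `z` is the gradient
of the primitive based at `s` of `e^(σ t) v`. -/
theorem exists_gradSpace_coercive (hT : 0 ≤ T) {s s' σ : ℝ} (hss : OppositeEnds T s s' σ)
    (hs : s ∈ Icc 0 T) (hs' : s' ∈ Icc 0 T) {w : L2Grad Ω T} (hw : w ∈ gradSpace Ω hs') :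
    ∃ z ∈ gradSpace Ω hs,
      Real.exp (-T) / 2 * ‖z‖ ^ 2 ≤ |inner ℝ z (timeReflection Ω T w)| ∧
      ‖timePrimitiveL Ω hs' (w none)‖ ≤ Real.exp T * ‖z‖ := by
  have hexp : ContDiff ℝ (⊤ : ℕ∞) fun t : ℝ => Real.exp (σ * t) := by fun_prop
  set v := timePrimitive s' (w none) with hv
  have hvL : MemLp v 2 (volume.restrict (cyl Ω T)) := memLp_timePrimitive hs' (Lp.memLp _)
  have hevL := memLp_exp_mul σ hvL
  have hqL : ∀ i, MemLp (fun p => Real.exp (σ * p.2) * w (some i) p) 2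
      (volume.restrict (cyl Ω T)) := fun i => memLp_exp_mul σ (Lp.memLp _)
  have hPL := fun i => memLp_timePrimitive hs (hqL i)
  let z : L2Grad Ω T := WithLp.toLp 2 fun o =>
    o.elim (hevL.toLp _) fun i => (hPL i).toLp _
  have hz0 : z none =ᵐ[volume.restrict (cyl Ω T)] fun p => Real.exp (σ * p.2) * v p :=
    hevL.coeFn_toLp
  have hz1 : ∀ i, z (some i) =ᵐ[volume.restrict (cyl Ω T)]
      timePrimitive s fun p => Real.exp (σ * p.2) * w (some i) p := fun i => (hPL i).coeFn_toLp
  have hzmem : z ∈ gradSpace Ω hs := by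
    refine (mem_gradSpace hs).2 fun i => ?_
    have h1 : HasWeakDeriv (cyl Ω T) v (w (some i)) (dirX i) := (mem_gradSpace hs').1 hw i
    exact (hasWeakDeriv_dirX_timePrimitive hs hevL (hqL i) (h1.mul_time hexp)).congr
      (timePrimitive_congr hs hz0.symm) (hz1 i).symm
  have hE : Real.exp (-T) * Real.exp T = 1 := by rw [← Real.exp_add]; simp
  -- the time component: the energy estimate for `v`, as the primitive of `w none` based at `s'`
  have hb0 : ‖z none‖ ^ 2 ≤ Real.exp T * (-2 * σ * inner ℝ (z none) (w none)) := by
    have h1 := integral_exp_mul_sq_timePrimitive_le hT hss.symm (Lp.memLp (w none))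
    rw [neg_neg] at h1
    have h2 : ∫ p in cyl Ω T, Real.exp (σ * p.2) * (v p * w none p) =
        inner ℝ (z none) (w none) := by
      rw [inner_L2_eq_integral]
      refine integral_congr_ae ?_
      filter_upwards [hz0] with p hp
      rw [hp]
      ring
    have i1 : Integrable (fun p => Real.exp (σ * p.2) * v p ^ 2) (volume.restrict (cyl Ω T)) := by
      refine (integrable_mul_of_memLp_two hevL hvL).congr
        (Filter.Eventually.of_forall fun p => ?_)
      simp only
      ring
    have h3 : ‖z none‖ ^ 2 ≤ Real.exp T * ∫ p in cyl Ω T, Real.exp (σ * p.2) * v p ^ 2 := by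
      rw [norm_sq_L2_eq_integral, ← integral_const_mul]
      refine integral_mono_ae (Lp.memLp (z none)).integrable_sq (i1.const_mul _) ?_
      filter_upwards [hz0, ae_cyl_snd_mem Ω T] with p hp hpT
      rw [hp]
      have := hss.exp_le (Ioo_subset_Icc_self hpT)
      have h4 : 0 ≤ Real.exp (σ * p.2) * v p ^ 2 := by positivity
      nlinarith
    refine h3.trans (mul_le_mul_of_nonneg_left ?_ (Real.exp_nonneg _))
    rw [← h2]
    linarith
  -- the spatial components: the energy estimate for the primitives based at `s`
  have hb1 : ∀ i, ‖z (some i)‖ ^ 2 ≤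
      Real.exp T * (2 * σ * inner ℝ (z (some i)) (w (some i))) := by
    intro i
    have h1 := integral_exp_mul_sq_timePrimitive_le hT hss (hqL i)
    have h2 : ∫ p in cyl Ω T, Real.exp (-σ * p.2) *
        (timePrimitive s (fun p => Real.exp (σ * p.2) * w (some i) p) p *
          (Real.exp (σ * p.2) * w (some i) p)) = inner ℝ (z (some i)) (w (some i)) := by
      rw [inner_L2_eq_integral]
      refine integral_congr_ae ?_
      filter_upwards [hz1 i] with p hp
      rw [hp]
      have : Real.exp (-σ * p.2) * Real.exp (σ * p.2) = 1 := by rw [← Real.exp_add]; simp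
      linear_combination
        timePrimitive s (fun p => Real.exp (σ * p.2) * w (some i) p) p * w (some i) p * this
    have i1 : Integrable (fun p => Real.exp (-σ * p.2) *
        timePrimitive s (fun p => Real.exp (σ * p.2) * w (some i) p) p ^ 2)
        (volume.restrict (cyl Ω T)) := by
      refine (integrable_mul_of_memLp_two (memLp_exp_mul (-σ) (hPL i)) (hPL i)).congr
        (Filter.Eventually.of_forall fun p => ?_)
      simp only
      ring
    have h3 : ‖z (some i)‖ ^ 2 ≤ Real.exp T * ∫ p in cyl Ω T, Real.exp (-σ * p.2) *
        timePrimitive s (fun p => Real.exp (σ * p.2) * w (some i) p) p ^ 2 := by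
      rw [norm_sq_L2_eq_integral, ← integral_const_mul]
      refine integral_mono_ae (Lp.memLp (z (some i))).integrable_sq (i1.const_mul _) ?_
      filter_upwards [hz1 i, ae_cyl_snd_mem Ω T] with p hp hpT
      rw [hp]
      have h4 := hss.exp_le (Ioo_subset_Icc_self hpT)
      have h5 : Real.exp (-σ * p.2) * Real.exp (σ * p.2) = 1 := by rw [← Real.exp_add]; simp
      have h6 : 1 ≤ Real.exp T * Real.exp (-σ * p.2) := by
        rw [← h5, mul_comm]
        exact mul_le_mul_of_nonneg_right h4 (Real.exp_nonneg _)
      rw [← mul_assoc]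
      exact le_mul_of_one_le_left (sq_nonneg _) h6
    refine h3.trans (mul_le_mul_of_nonneg_left ?_ (Real.exp_nonneg _))
    rw [← h2]
    linarith
  have hσ : |σ| = 1 := by
    rcases hss with ⟨-, -, rfl⟩ | ⟨-, -, rfl⟩ <;> simp
  refine ⟨z, hzmem, ?_, ?_⟩
  · have h1 : ‖z‖ ^ 2 ≤ Real.exp T * (2 * (σ * inner ℝ z (timeReflection Ω T w))) := by
      rw [norm_sq_L2Grad, inner_timeReflection]
      refine (add_le_add hb0 (Finset.sum_le_sum fun i _ => hb1 i)).trans_eq ?_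
      rw [← Finset.mul_sum, ← Finset.mul_sum]
      ring
    have h2 : σ * inner ℝ z (timeReflection Ω T w) ≤ |inner ℝ z (timeReflection Ω T w)| := by
      refine (le_abs_self _).trans_eq ?_
      rw [abs_mul, hσ, one_mul]
    refine le_trans ?_ h2
    have h3 := mul_le_mul_of_nonneg_left h1 (Real.exp_nonneg (-T))
    rw [← mul_assoc, hE, one_mul] at h3
    linarith
  · have h1 : ‖timePrimitiveL Ω hs' (w none)‖ ≤ Real.exp T * ‖z none‖ := by
      rw [← sq_le_sq₀ (norm_nonneg _) (by positivity), mul_pow, norm_sq_L2_eq_integral,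
        norm_sq_L2_eq_integral, ← integral_const_mul]
      refine integral_mono_ae (Lp.memLp _).integrable_sq
        ((Lp.memLp (z none)).integrable_sq.const_mul _) ?_
      filter_upwards [coeFn_timePrimitiveL hs' (w none), hz0, ae_cyl_snd_mem Ω T] with p h1 h2 hpT
      rw [h1, h2, ← mul_pow, ← mul_assoc, mul_pow]
      refine le_mul_of_one_le_left (sq_nonneg _) (one_le_pow₀ ?_)
      have h3 := hss.symm.exp_le (Ioo_subset_Icc_self hpT)
      have h5 : Real.exp (-σ * p.2) * Real.exp (σ * p.2) = 1 := by rw [← Real.exp_add]; simp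
      rw [← h5]
      exact mul_le_mul_of_nonneg_right h3 (Real.exp_nonneg _)
    refine h1.trans (mul_le_mul_of_nonneg_left ?_ (Real.exp_nonneg _))
    exact PiLp.norm_apply_le z none

/-- Generalized solutions of the wave equation with zero data at the end `s` of `[0,T]`, with test
functions that vanish at the other end `s'`. It unfolds to `IsForwardSolution` for `s = 0`, `s' = T`
and to `IsBackwardSolution` for `s = T`, `s' = 0`. -/
def IsWaveSolution (Ω : Set (Space n)) (T s s' : ℝ) (F u : Space n × ℝ → ℝ) : Prop :=
  MemH1 (cyl Ω T) u ∧ TraceZero Ω T s u ∧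
  ∀ v : Space n × ℝ → ℝ, MemH1 (cyl Ω T) v → TraceZero Ω T s' v →
    waveForm Ω T u v = ∫ p in cyl Ω T, F p * v p

theorem IsGradient.congr {z : L2Grad Ω T} {u u' : Space n × ℝ → ℝ}
    (h : IsGradient z u) (hu : u =ᵐ[volume.restrict (cyl Ω T)] u') : IsGradient z u' :=
  ⟨h.1.congr hu ae_eq_rfl, fun i => (h.2 i).congr hu ae_eq_rfl⟩

/-- The equation in terms of gradients. -/
theorem isWaveSolution_iff (hΩ : IsOpen Ω) (hT : 0 < T) {s s' : ℝ} (hs : s ∈ Icc 0 T)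
    (hs' : s' ∈ Icc 0 T) {F u : Space n × ℝ → ℝ} :
    IsWaveSolution Ω T s s' F u ↔ ∃ z ∈ gradSpace Ω hs,
      u =ᵐ[volume.restrict (cyl Ω T)] timePrimitive s (z none) ∧
      ∀ w ∈ gradSpace Ω hs', inner ℝ z (timeReflection Ω T w) =
        ∫ p in cyl Ω T, F p * timePrimitive s' (w none) p := by
  constructor
  · rintro ⟨h1, h2, h3⟩
    obtain ⟨z, hz, hzu, hu⟩ := exists_gradient_of_traceZero hΩ hT hs h1 h2
    refine ⟨z, hz, hu, fun w hw => ?_⟩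
    rw [← h3 _ (memH1_timePrimitive hs' hw) (traceZero_timePrimitive hs' (Lp.memLp _)),
      waveForm_eq_inner hΩ hzu (isGradient_timePrimitive hs' hw)]
  · rintro ⟨z, hz, hu, h⟩
    have hzu := IsGradient.congr (isGradient_timePrimitive hs hz) hu.symm
    refine ⟨⟨(memLp_congr_ae hu).2 (memLp_timePrimitive hs (Lp.memLp _)),
      fun i => ⟨_, Lp.memLp _, hzu.2 i⟩, ⟨_, Lp.memLp _, hzu.1⟩⟩,
      (traceZero_timePrimitive hs (Lp.memLp _)).congr hu.symm, fun v hv htr => ?_⟩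
    obtain ⟨w, hw, hwv, hv'⟩ := exists_gradient_of_traceZero hΩ hT hs' hv htr
    rw [waveForm_eq_inner hΩ hzu hwv, h w hw]
    refine integral_congr_ae ?_
    filter_upwards [hv'] with p hp
    rw [hp]

theorem exists_isWaveSolution (hΩ : IsOpen Ω) (hT : 0 < T) {s s' σ : ℝ}
    (hss : OppositeEnds T s s' σ) {F : Space n × ℝ → ℝ}
    (hF : MemLp F 2 (volume.restrict (cyl Ω T))) :
    ∃ u : L2Cyl Ω T, IsWaveSolution Ω T s s' F u := by
  have hs := hss.left_mem hT.le
  have hs' := hss.symm.left_mem hT.le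
  obtain ⟨z, hz, h⟩ := exists_mem_forall_inner_eq (gradSpace Ω hs) (isClosed_gradSpace hs)
    (timeReflection Ω T ∘ₗ (gradSpace Ω hs').subtype)
    (((innerSL ℝ (hF.toLp F)).comp
      ((timePrimitiveL Ω hs').comp (PiLp.proj 2 _ none))).toLinearMap ∘ₗ
        (gradSpace Ω hs').subtype)
    (c := Real.exp (-T) / 2) (C := ‖hF.toLp F‖ * Real.exp T) (by positivity) (by positivity) (by
      rintro ⟨w, hw⟩
      obtain ⟨z, hz, h1, h2⟩ := exists_gradSpace_coercive hT.le hss hs hs' hw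
      refine ⟨z, hz, h1, ?_⟩
      rw [mul_assoc]
      exact (abs_real_inner_le_norm _ _).trans (mul_le_mul_of_nonneg_left h2 (norm_nonneg _)))
  refine ⟨timePrimitiveL Ω hs (z none), (isWaveSolution_iff hΩ hT hs hs').2
    ⟨z, hz, coeFn_timePrimitiveL hs _, fun w hw => ?_⟩⟩
  refine (h ⟨w, hw⟩).trans ?_
  change inner ℝ (hF.toLp F) (timePrimitiveL Ω hs' (w none)) = _
  rw [inner_L2_eq_integral]
  refine integral_congr_ae ?_
  filter_upwards [hF.coeFn_toLp, coeFn_timePrimitiveL hs' (w none)] with p h1 h2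
  rw [h1, h2]

/-- Uniqueness, from the coercivity estimate with the two ends exchanged. -/
theorem timePrimitive_ae_eq_zero_of_inner_eq_zero (hT : 0 < T) {s s' σ : ℝ}
    (hss : OppositeEnds T s s' σ) (hs : s ∈ Icc 0 T) (hs' : s' ∈ Icc 0 T) {z : L2Grad Ω T}
    (hz : z ∈ gradSpace Ω hs)
    (h : ∀ w ∈ gradSpace Ω hs', inner ℝ z (timeReflection Ω T w) = 0) :
    timePrimitive s (z none) =ᵐ[volume.restrict (cyl Ω T)] 0 := by
  obtain ⟨w, hw, h1, h2⟩ := exists_gradSpace_coercive hT.le hss.symm hs' hs hz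
  rw [inner_timeReflection_comm, h w hw, abs_zero] at h1
  have hw0 : ‖w‖ = 0 := by
    have hc : 0 < Real.exp (-T) / 2 := by positivity
    have : ‖w‖ ^ 2 ≤ 0 := by
      by_contra hcon
      exact absurd h1 (not_le.2 (mul_pos hc (not_le.1 hcon)))
    exact pow_eq_zero_iff two_ne_zero |>.1 (le_antisymm this (sq_nonneg _))
  rw [hw0, mul_zero] at h2
  have h3 : timePrimitiveL Ω hs (z none) = 0 := norm_le_zero_iff.1 h2
  have h4 := coeFn_timePrimitiveL hs (z none)
  rw [h3] at h4
  exact h4.symm.trans (Lp.coeFn_zero _ _ _)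

theorem IsWaveSolution.add_smul (hΩ : IsOpen Ω) (hT : 0 < T) {s s' : ℝ} (hs : s ∈ Icc 0 T)
    (hs' : s' ∈ Icc 0 T) {F G u v : Space n × ℝ → ℝ}
    (hF : MemLp F 2 (volume.restrict (cyl Ω T))) (hG : MemLp G 2 (volume.restrict (cyl Ω T)))
    (hu : IsWaveSolution Ω T s s' F u) (hv : IsWaveSolution Ω T s s' G v) (c : ℝ) :
    IsWaveSolution Ω T s s' (F + c • G) (u + c • v) := by
  rw [isWaveSolution_iff hΩ hT hs hs'] at hu hv ⊢
  obtain ⟨z, hz, hzu, h1⟩ := hu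
  obtain ⟨z', hz', hzv, h2⟩ := hv
  refine ⟨z + c • z', add_mem hz (Submodule.smul_mem _ c hz'), ?_, fun w hw => ?_⟩
  · have h3 : timePrimitive s ((z + c • z') none) =ᵐ[volume.restrict (cyl Ω T)]
        timePrimitive s (z none) + c • timePrimitive s (z' none) := by
      rw [← timePrimitive_smul]
      refine (timePrimitive_congr hs ?_).trans
        (timePrimitive_add hs (Lp.memLp _) ((Lp.memLp (z' none)).const_smul c))
      filter_upwards [Lp.coeFn_add (z none) (c • z' none), Lp.coeFn_smul c (z' none)] with p e1 e2
      refine e1.trans ?_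
      rw [Pi.add_apply, Pi.add_apply, e2]
    refine Filter.EventuallyEq.trans ?_ h3.symm
    filter_upwards [hzu, hzv] with p e1 e2
    simp [e1, e2]
  · have hP : MemLp (timePrimitive s' (w none)) 2 (volume.restrict (cyl Ω T)) :=
      memLp_timePrimitive hs' (Lp.memLp _)
    rw [inner_add_left, real_inner_smul_left, h1 w hw, h2 w hw, ← integral_const_mul,
      ← integral_add (integrable_mul_of_memLp_two hF hP)
        ((integrable_mul_of_memLp_two hG hP).const_mul c)]
    congr 1
    ext p
    simp only [Pi.add_apply, Pi.smul_apply, smul_eq_mul]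
    ring

theorem IsWaveSolution.ae_unique (hΩ : IsOpen Ω) (hT : 0 < T) {s s' σ : ℝ}
    (hss : OppositeEnds T s s' σ) {F u v : Space n × ℝ → ℝ}
    (hu : IsWaveSolution Ω T s s' F u) (hv : IsWaveSolution Ω T s s' F v) :
    u =ᵐ[volume.restrict (cyl Ω T)] v := by
  have hs := hss.left_mem hT.le
  have hs' := hss.symm.left_mem hT.le
  rw [isWaveSolution_iff hΩ hT hs hs'] at hu hv
  obtain ⟨z, hz, hzu, h1⟩ := hu
  obtain ⟨z', hz', hzv, h2⟩ := hv
  have h3 := timePrimitive_ae_eq_zero_of_inner_eq_zero hT hss hs hs' (sub_mem hz hz') fun w hw => by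
    rw [inner_sub_left, h1 w hw, h2 w hw, sub_self]
  have h4 : timePrimitiveL Ω hs ((z - z') none) =
      timePrimitiveL Ω hs (z none) - timePrimitiveL Ω hs (z' none) := map_sub _ _ _
  have h5 := coeFn_timePrimitiveL hs ((z - z') none)
  rw [h4] at h5
  filter_upwards [hzu, hzv, h3, h5, coeFn_timePrimitiveL hs (z none),
    coeFn_timePrimitiveL hs (z' none), Lp.coeFn_sub (timePrimitiveL Ω hs (z none))
      (timePrimitiveL Ω hs (z' none))] with p e1 e2 e3 e4 e5 e6 e7
  rw [e7, Pi.sub_apply, e5, e6, e3, Pi.zero_apply, sub_eq_zero] at e4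
  rw [e1, e2, e4]

/-! ### The Tikhonov functional and its Euler equation -/

variable {ω : Set (Space n)}

/-- No measurability of `t ↦ ‖R(·, t)‖_∞` is needed, since only upper bounds of lower integrals
enter. -/
theorem memLp_source {R : Space n × ℝ → ℝ} (hR : MemL2Linfty Ω T R) (f : L2Space Ω) :
    MemLp (source R f) 2 (volume.restrict (cyl Ω T)) := by
  have hfm : AEStronglyMeasurable (fun p : Space n × ℝ => f p.1) (volume.restrict (cyl Ω T)) := by
    rw [restrict_cyl]
    exact (Lp.aestronglyMeasurable f).comp_fst
  have hm : AEStronglyMeasurable (source R f) (volume.restrict (cyl Ω T)) := hfm.mul hR.1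
  refine ⟨hm, ?_⟩
  rw [eLpNorm_lt_top_iff_lintegral_rpow_enorm_lt_top two_ne_zero ENNReal.ofNat_ne_top]
  simp only [ENNReal.toReal_ofNat, ENNReal.rpow_ofNat]
  have hA : ∫⁻ x in Ω, ‖f x‖ₑ ^ 2 < ⊤ := by
    have := (Lp.memLp f).2
    rw [eLpNorm_lt_top_iff_lintegral_rpow_enorm_lt_top two_ne_zero ENNReal.ofNat_ne_top] at this
    simpa only [ENNReal.toReal_ofNat, ENNReal.rpow_ofNat] using this
  have hm2 : AEMeasurable (fun p => ‖source R f p‖ₑ ^ 2) (volume.restrict (cyl Ω T)) :=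
    hm.enorm.pow_const 2
  rw [restrict_cyl] at hm2 ⊢
  rw [lintegral_prod_symm _ hm2]
  calc ∫⁻ t in Ioo 0 T, ∫⁻ x in Ω, ‖source R f (x, t)‖ₑ ^ 2
      ≤ ∫⁻ t in Ioo 0 T, eLpNorm (fun x => R (x, t)) ⊤ (volume.restrict Ω) ^ 2 *
          ∫⁻ x in Ω, ‖f x‖ₑ ^ 2 := by
        refine lintegral_mono fun t => ?_
        rw [← lintegral_const_mul'' _ ((Lp.aestronglyMeasurable f).enorm.pow_const 2)]
        refine lintegral_mono_ae ?_
        filter_upwards [enorm_ae_le_eLpNormEssSup (fun x => R (x, t)) (volume.restrict Ω)]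
          with x hx
        rw [eLpNorm_exponent_top, ← mul_pow, mul_comm, source, enorm_mul]
        gcongr
    _ = (∫⁻ t in Ioo 0 T, eLpNorm (fun x => R (x, t)) ⊤ (volume.restrict Ω) ^ 2) *
          ∫⁻ x in Ω, ‖f x‖ₑ ^ 2 := lintegral_mul_const' _ _ hA.ne
    _ < ⊤ := ENNReal.mul_lt_top hR.2 hA

theorem cyl_inter_fst_mem (hωΩ : ω ⊆ Ω) (T : ℝ) :
    {p : Space n × ℝ | p.1 ∈ ω} ∩ cyl Ω T = cyl ω T := by
  ext p
  exact ⟨fun h => ⟨h.1, h.2.2⟩, fun h => ⟨h.1, hωΩ h.1, h.2⟩⟩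

theorem memLp_cyl_mono (hωΩ : ω ⊆ Ω) {u : Space n × ℝ → ℝ}
    (hu : MemLp u 2 (volume.restrict (cyl Ω T))) : MemLp u 2 (volume.restrict (cyl ω T)) :=
  hu.mono_measure (Measure.restrict_mono (prod_mono hωΩ le_rfl) le_rfl)

theorem measurableSet_fst_mem (hω : IsOpen ω) :
    MeasurableSet {p : Space n × ℝ | p.1 ∈ ω} := (hω.preimage continuous_fst).measurableSet

theorem memLp_adjointSource (hω : IsOpen ω) (hωΩ : ω ⊆ Ω) (R : Space n × ℝ → ℝ)
    (uδ : L2Cyl ω T) (f : L2Space Ω) :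
    MemLp (adjointSource T R uδ f) 2 (volume.restrict (cyl Ω T)) := by
  rw [adjointSource, memLp_indicator_iff_restrict (measurableSet_fst_mem hω),
    Measure.restrict_restrict (measurableSet_fst_mem hω), cyl_inter_fst_mem hωΩ]
  exact (memLp_cyl_mono hωΩ (Lp.memLp _)).sub (Lp.memLp uδ)

theorem integral_adjointSource_mul (hω : IsOpen ω) (hωΩ : ω ⊆ Ω) (R : Space n × ℝ → ℝ)
    (uδ : L2Cyl ω T) (f : L2Space Ω) (w : Space n × ℝ → ℝ) :
    ∫ p in cyl Ω T, adjointSource T R uδ f p * w p =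
      ∫ p in cyl ω T, (fwd T R f p - uδ p) * w p := by
  have h : ∀ p, adjointSource T R uδ f p * w p =
      {p : Space n × ℝ | p.1 ∈ ω}.indicator (fun p => (fwd T R f p - uδ p) * w p) p := by
    intro p
    rw [adjointSource, ← indicator_mul_left]
  simp only [h]
  rw [integral_indicator (measurableSet_fst_mem hω),
    Measure.restrict_restrict (measurableSet_fst_mem hω), cyl_inter_fst_mem hωΩ]

theorem waveForm_comm (Ω : Set (Space n)) (T : ℝ) (u v : Space n × ℝ → ℝ) :
    waveForm Ω T u v = waveForm Ω T v u := by
  simp only [waveForm, mul_comm]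

theorem isForwardSolution_fwd (hΩ : IsOpen Ω) (hT : 0 < T) {R : Space n × ℝ → ℝ}
    (hR : MemL2Linfty Ω T R) (f : L2Space Ω) :
    IsForwardSolution Ω T (source R f) (fwd T R f) :=
  Classical.epsilon_spec (exists_isWaveSolution hΩ hT (Or.inl ⟨rfl, rfl, rfl⟩) (memLp_source hR f))

theorem isBackwardSolution_bwd (hΩ : IsOpen Ω) (hω : IsOpen ω) (hωΩ : ω ⊆ Ω) (hT : 0 < T)
    (R : Space n × ℝ → ℝ) (uδ : L2Cyl ω T) (f : L2Space Ω) :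
    IsBackwardSolution Ω T (adjointSource T R uδ f) (bwd T R uδ f) :=
  Classical.epsilon_spec (exists_isWaveSolution hΩ hT (Or.inr ⟨rfl, rfl, rfl⟩)
    (memLp_adjointSource hω hωΩ R uδ f))

theorem fwd_add_smul (hΩ : IsOpen Ω) (hT : 0 < T) {R : Space n × ℝ → ℝ}
    (hR : MemL2Linfty Ω T R) (f h : L2Space Ω) (ε : ℝ) :
    fwd T R (f + ε • h) =ᵐ[volume.restrict (cyl Ω T)]
      fun p => fwd T R f p + ε * fwd T R h p := by
  have hs : (0 : ℝ) ∈ Icc 0 T := ⟨le_rfl, hT.le⟩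
  have hs' : T ∈ Icc 0 T := ⟨hT.le, le_rfl⟩
  have h1 : IsWaveSolution Ω T 0 T (source R f + ε • source R h) (fwd T R f + ε • fwd T R h) :=
    IsWaveSolution.add_smul hΩ hT hs hs' (memLp_source hR f) (memLp_source hR h)
      (isForwardSolution_fwd hΩ hT hR f) (isForwardSolution_fwd hΩ hT hR h) ε
  have h2 : IsWaveSolution Ω T 0 T (source R (f + ε • h)) (fwd T R (f + ε • h)) :=
    isForwardSolution_fwd hΩ hT hR _
  have hF : source R f + ε • source R h =ᵐ[volume.restrict (cyl Ω T)] source R (f + ε • h) := by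
    filter_upwards [ae_cyl_of_ae_fst (T := T) (Lp.coeFn_add f (ε • h)),
      ae_cyl_of_ae_fst (T := T) (Lp.coeFn_smul ε h)] with p e1 e2
    simp only [source, Pi.add_apply, Pi.smul_apply, smul_eq_mul] at e1 e2 ⊢
    rw [e1, e2]
    ring
  have h3 : IsWaveSolution Ω T 0 T (source R (f + ε • h)) (fwd T R f + ε • fwd T R h) := by
    refine ⟨h1.1, h1.2.1, fun v hv hvT => ?_⟩
    rw [h1.2.2 v hv hvT]
    exact integral_congr_ae (by filter_upwards [hF] with p hp using by rw [hp])
  exact h2.ae_unique hΩ hT (Or.inl ⟨rfl, rfl, rfl⟩) h3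

theorem tikhonov_add_smul (hΩ : IsOpen Ω) (hωΩ : ω ⊆ Ω) (hT : 0 < T) {R : Space n × ℝ → ℝ}
    (hR : MemL2Linfty Ω T R) (uδ : L2Cyl ω T) (α : ℝ) (f h : L2Space Ω) (ε : ℝ) :
    tikhonov T α R uδ (f + ε • h) = tikhonov T α R uδ f +
      2 * ε * ((∫ p in cyl ω T, (fwd T R f p - uδ p) * fwd T R h p) + α * inner ℝ f h) +
      ε ^ 2 * ((∫ p in cyl ω T, fwd T R h p ^ 2) + α * ‖h‖ ^ 2) := by
  have hA : MemLp (fun p => fwd T R f p - uδ p) 2 (volume.restrict (cyl ω T)) :=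
    (memLp_cyl_mono hωΩ (Lp.memLp _)).sub (Lp.memLp uδ)
  have hB : MemLp (fwd T R h) 2 (volume.restrict (cyl ω T)) :=
    memLp_cyl_mono hωΩ (Lp.memLp _)
  have hle : (volume : Measure (Space n × ℝ)).restrict (cyl ω T) ≤ volume.restrict (cyl Ω T) :=
    Measure.restrict_mono (prod_mono hωΩ le_rfl) le_rfl
  have e : ∫ p in cyl ω T, (fwd T R (f + ε • h) p - uδ p) ^ 2 =
      ∫ p in cyl ω T, ((fwd T R f p - uδ p) ^ 2 +
        2 * ε * ((fwd T R f p - uδ p) * fwd T R h p) + ε ^ 2 * fwd T R h p ^ 2) := by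
    refine integral_congr_ae ?_
    filter_upwards [ae_mono hle (fwd_add_smul hΩ hT hR f h ε)] with p hp
    rw [hp]
    ring
  have i1 := (integrable_mul_of_memLp_two hA hB).const_mul (2 * ε)
  have i2 : Integrable (fun p => (fwd T R f p - uδ p) ^ 2 +
      2 * ε * ((fwd T R f p - uδ p) * fwd T R h p)) (volume.restrict (cyl ω T)) :=
    hA.integrable_sq.add i1
  rw [tikhonov, e, integral_add i2 (hB.integrable_sq.const_mul _),
    integral_add hA.integrable_sq i1, integral_const_mul, integral_const_mul,
    @norm_add_sq_real, real_inner_smul_right, norm_smul, mul_pow, Real.norm_eq_abs, sq_abs,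
    tikhonov]
  ring

/-- The choice `ε = -a / (b + 1)` makes the quadratic negative unless `a = 0`. -/
theorem eq_zero_of_forall_nonneg_quadratic {a b : ℝ} (hb : 0 ≤ b)
    (h : ∀ ε : ℝ, 0 ≤ 2 * ε * a + ε ^ 2 * b) : a = 0 := by
  have h1 := h (-a / (b + 1))
  have h2 : 2 * (-a / (b + 1)) * a + (-a / (b + 1)) ^ 2 * b = -(a ^ 2 * (b + 2)) / (b + 1) ^ 2 := by
    field_simp
    ring
  rw [h2, le_div_iff₀ (by positivity), zero_mul] at h1
  have h3 : a ^ 2 ≤ 0 := by nlinarith [sq_nonneg a]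
  exact pow_eq_zero_iff two_ne_zero |>.1 (le_antisymm h3 (sq_nonneg a))

/-- The Euler equation in weak form. The adjoint state tested with `u(h)` and the forward state
`u(h)` tested with the adjoint state give the same value of the symmetric form `waveForm`. -/
theorem integral_source_mul_bwd_add_eq_zero (hΩ : IsOpen Ω) (hω : IsOpen ω) (hωΩ : ω ⊆ Ω)
    (hT : 0 < T) {α : ℝ} (hα : 0 < α) {R : Space n × ℝ → ℝ} (hR : MemL2Linfty Ω T R)
    (uδ : L2Cyl ω T) {f : L2Space Ω}
    (hf : ∀ g : L2Space Ω, tikhonov T α R uδ f ≤ tikhonov T α R uδ g) (h : L2Space Ω) :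
    (∫ p in cyl Ω T, source R h p * bwd T R uδ f p) + α * ∫ x in Ω, f x * h x = 0 := by
  have h1 : (∫ p in cyl ω T, (fwd T R f p - uδ p) * fwd T R h p) + α * inner ℝ f h = 0 := by
    refine eq_zero_of_forall_nonneg_quadratic
      (b := (∫ p in cyl ω T, fwd T R h p ^ 2) + α * ‖h‖ ^ 2) ?_ fun ε => ?_
    · have : 0 ≤ ∫ p in cyl ω T, fwd T R h p ^ 2 := integral_nonneg fun p => sq_nonneg _
      positivity
    · have := hf (f + ε • h)
      rw [tikhonov_add_smul hΩ hωΩ hT hR] at this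
      linarith
  have hu := isForwardSolution_fwd hΩ hT hR h
  have hv := isBackwardSolution_bwd hΩ hω hωΩ hT R uδ f
  rw [← hu.2.2 _ hv.1 hv.2.1, waveForm_comm, hv.2.2 _ hu.1 hu.2.1,
    integral_adjointSource_mul hω hωΩ, ← inner_L2_eq_integral]
  exact h1

/-- The weak form, tested with indicator functions. -/
theorem ae_euler_equation_of_integral [IsFiniteMeasure ((volume : Measure (Space n)).restrict Ω)]
    {α : ℝ} {R v : Space n × ℝ → ℝ} (hR : MemL2Linfty Ω T R)
    (hv : MemLp v 2 (volume.restrict (cyl Ω T))) {f : L2Space Ω}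
    (h : ∀ g : L2Space Ω, (∫ p in cyl Ω T, source R g p * v p) + α * ∫ x in Ω, f x * g x = 0) :
    ∀ᵐ x ∂(volume.restrict Ω), IntegrableOn (fun t => R (x, t) * v (x, t)) (Ioo 0 T) ∧
      (∫ t in Ioo 0 T, R (x, t) * v (x, t)) + α * f x = 0 := by
  have hind : ∀ {E : Set (Space n)} (hE : MeasurableSet E),
      source R (indicatorConstLp 2 hE (measure_ne_top (volume.restrict Ω) E) (1 : ℝ))
        =ᵐ[volume.restrict (cyl Ω T)] fun p => E.indicator (fun _ => (1 : ℝ)) p.1 * R p := by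
    intro E hE
    filter_upwards [ae_cyl_of_ae_fst (T := T) (indicatorConstLp_coeFn (p := 2) (hs := hE)
      (hμs := measure_ne_top (volume.restrict Ω) E) (c := (1 : ℝ)))] with p hp
    rw [source, hp]
  have hRv : Integrable (fun p => R p * v p) (volume.restrict (cyl Ω T)) := by
    refine (integrable_mul_of_memLp_two (memLp_source hR (indicatorConstLp 2 MeasurableSet.univ
      (measure_ne_top (volume.restrict Ω) univ) 1)) hv).congr ?_
    filter_upwards [hind MeasurableSet.univ] with p hp
    rw [hp]
    simp
  have hRv' := hRv
  rw [restrict_cyl] at hRv'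
  have hf : Integrable f (volume.restrict Ω) := (Lp.memLp f).integrable one_le_two
  have hi := hRv'.integral_prod_left.add (hf.const_mul α)
  have h0 := hi.ae_eq_zero_of_forall_setIntegral_eq_zero fun E hE _ => by
    have e := h (indicatorConstLp 2 hE (measure_ne_top (volume.restrict Ω) E) (1 : ℝ))
    have e1 : ∫ p in cyl Ω T,
        source R (indicatorConstLp 2 hE (measure_ne_top (volume.restrict Ω) E) (1 : ℝ)) p * v p =
        ∫ x in E, ∫ t in Ioo 0 T, R (x, t) * v (x, t) ∂volume ∂(volume.restrict Ω) := by
      have : ∫ p in cyl Ω T, source R (indicatorConstLp 2 hE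
          (measure_ne_top (volume.restrict Ω) E) (1 : ℝ)) p * v p =
          ∫ p in cyl Ω T, E.indicator (fun _ => (1 : ℝ)) p.1 * (R p * v p) :=
        integral_congr_ae (by filter_upwards [hind hE] with p hp using by rw [hp, mul_assoc])
      rw [this, integral_cyl, ← integral_indicator hE]
      · congr 1
        ext x
        simp only [integral_const_mul]
        by_cases hx : x ∈ E <;> simp [hx]
      · refine hRv.bdd_mul (c := 1) ?_ (Filter.Eventually.of_forall fun p => ?_)
        · exact ((measurable_const.indicator hE).comp measurable_fst).aestronglyMeasurable
        · by_cases hx : p.1 ∈ E <;> simp [hx]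
    have e2 : ∫ x in Ω, f x * indicatorConstLp 2 hE (measure_ne_top (volume.restrict Ω) E)
        (1 : ℝ) x = ∫ x in E, f x ∂(volume.restrict Ω) := by
      rw [← integral_indicator hE]
      refine integral_congr_ae ?_
      filter_upwards [indicatorConstLp_coeFn (p := 2) (hs := hE)
        (hμs := measure_ne_top (volume.restrict Ω) E) (c := (1 : ℝ))] with x hx
      rw [hx]
      by_cases hx : x ∈ E <;> simp [hx]
    rw [e1, e2, ← integral_const_mul] at e
    exact (integral_add hRv'.integral_prod_left.integrableOn (hf.const_mul α).integrableOn).trans e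
  filter_upwards [hRv'.prod_right_ae, h0] with x h1 h2
  exact ⟨h1, h2⟩

end NeumannWave

end

theorem proposition4p1 {n : ℕ} (hn : 1 ≤ n)
    (Ω ω : Set (NeumannWave.Space n)) (hΩ : IsOpen Ω) (hΩb : Bornology.IsBounded Ω)
    (hω : IsOpen ω) (hωΩ : ω ⊆ Ω) (T α : ℝ) (hT : 0 < T) (hα : 0 < α)
    (R : NeumannWave.Space n × ℝ → ℝ) (hR : NeumannWave.MemL2Linfty Ω T R)
    (uδ : NeumannWave.L2Cyl ω T) :
    -- the forward problem is well-posed, and `u(f)` is its solution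
    (∀ f : NeumannWave.L2Space Ω,
      NeumannWave.IsForwardSolution Ω T (NeumannWave.source R f) (NeumannWave.fwd T R f) ∧
      ∀ u : NeumannWave.L2Cyl Ω T,
        NeumannWave.IsForwardSolution Ω T (NeumannWave.source R f) u →
          u = NeumannWave.fwd T R f) ∧
    -- the adjoint problem is well-posed, and `v(f)` is its solution
    (∀ f : NeumannWave.L2Space Ω,
      NeumannWave.IsBackwardSolution Ω T (NeumannWave.adjointSource T R uδ f)
        (NeumannWave.bwd T R uδ f) ∧
      ∀ v : NeumannWave.L2Cyl Ω T,
        NeumannWave.IsBackwardSolution Ω T (NeumannWave.adjointSource T R uδ f) v →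
          v = NeumannWave.bwd T R uδ f) ∧
    -- every minimizer of the Tikhonov functional satisfies the Euler equation
    ∀ fstar : NeumannWave.L2Space Ω,
      (∀ f : NeumannWave.L2Space Ω,
        NeumannWave.tikhonov T α R uδ fstar ≤ NeumannWave.tikhonov T α R uδ f) →
      ∀ᵐ x ∂(volume.restrict Ω),
        IntegrableOn (fun t => R (x, t) * NeumannWave.bwd T R uδ fstar (x, t)) (Ioo 0 T) ∧
        (∫ t in Ioo 0 T, R (x, t) * NeumannWave.bwd T R uδ fstar (x, t)) + α * fstar x = 0 := by
  have : IsFiniteMeasure ((volume : Measure (NeumannWave.Space n)).restrict Ω) :=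
    isFiniteMeasure_restrict.2 hΩb.measure_lt_top.ne
  refine ⟨fun f => ?_, fun f => ?_, fun f hf => ?_⟩
  · have hfwd := NeumannWave.isForwardSolution_fwd hΩ hT hR f
    exact ⟨hfwd, fun u hu => Lp.ext
      (NeumannWave.IsWaveSolution.ae_unique hΩ hT (Or.inl ⟨rfl, rfl, rfl⟩) hu hfwd)⟩
  · have hbwd := NeumannWave.isBackwardSolution_bwd hΩ hω hωΩ hT R uδ f
    exact ⟨hbwd, fun v hv => Lp.ext
      (NeumannWave.IsWaveSolution.ae_unique hΩ hT (Or.inr ⟨rfl, rfl, rfl⟩) hv hbwd)⟩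
  · exact NeumannWave.ae_euler_equation_of_integral hR (Lp.memLp _) fun h =>
      NeumannWave.integral_source_mul_bwd_add_eq_zero hΩ hω hωΩ hT hα hR uδ hf h
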